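/- For every integer $n\ge 2$ let $d=d_n\ge 2$ be an integer, $\boldsymbol\mu=\boldsymbol\mu_n\in\mathbb R^{d}$ and $\boldsymbol y=\boldsymbol y_n\in\{\pm1\}^n$ be deterministic, and let $$\boldsymbol x_i=y_i\boldsymbol\mu+\boldsymbol z_i\in\mathbb R^d,\qquad i=1,\dots,n,$$ where $\boldsymbol z_1,\dots,\boldsymbol z_n$ are i.i.d. $N(\boldsymbol 0,\boldsymbol I_d)$. Define $$\mathrm{SNR}=\mathrm{SNR}_n=\frac{\|\boldsymbol\mu\|_2^4}{\|\boldsymbol\mu\|_2^2+d/n}.$$ Let $\boldsymbol G\in\mathbb R^{n\times n}$ be the hollowed Gram matrix, $G_{ij}=\langle\boldsymbol x_i,\boldsymbol x_j\rangle$ for $i\ne j$ and $G_{ii}=0$; let $\boldsymbol u_1$ be a (measurable) unit eigenvector of $\boldsymbol G$ associated with its largest eigenvalue, and let $\hat{\boldsymbol y}=\operatorname{sgn}(\boldsymbol u_1)$ be its entrywise sign (with $\operatorname{sgn}(0)=0$). Define the misclassification rate $$\mathcal M(\hat{\boldsymbol y},\boldsymbol y)=\frac1n\min_{s=\pm1}\bigl|\{i\in\{1,\dots,n\}:\hat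 y_i\ne s\,y_i\}\bigr|.$$ Then, as $n\to\infty$ and with no further assumption on $d_n$: 1. If, for some constant $\varepsilon>0$, $\mathrm{SNR}>(2+\varepsilon)\log n$ for all sufficiently large $n$, then $\lim_{n\to\infty}\mathbb P[\mathcal M(\hat{\boldsymbol y},\boldsymbol y)=0]=1$. 2. If $\mathrm{SNR}\to\infty$ and $\mathrm{SNR}\le 2\log n$ for all sufficiently large $n$, then $$\limsup_{n\to\infty}\ \mathrm{SNR}^{-1}\log\mathbb E\,\mathcal M(\hat{\boldsymbol y},\boldsymbol y)\le-\tfrac12 ,$$ where $\log 0=-\infty$. -/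

import Mathlib

open MeasureTheory ProbabilityTheory Filter Topology
open scoped ENNReal

noncomputable section

/-- `x ∼ GMM(μ, y)`: `n, d ≥ 2`, the deterministic labels `y i` are `±1`, and
`x i = y i • μ + z i` with `z i` i.i.d. standard Gaussian vectors in `ℝ^d`. -/
structure IsGMM {n d : ℕ} {Ω : Type*} [MeasurableSpace Ω] (P : Measure Ω)
    (μ : EuclideanSpace ℝ (Fin d)) (y : Fin n → ℝ)
    (x : Fin n → Ω → EuclideanSpace ℝ (Fin d)) : Prop where
  two_le_n : 2 ≤ n
  two_le_d : 2 ≤ d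
  label : ∀ i, y i = 1 ∨ y i = -1
  model : ∃ z : Fin n → Ω → EuclideanSpace ℝ (Fin d),
    iIndepFun z P ∧
    (∀ i, HasLaw (z i) (stdGaussian (EuclideanSpace ℝ (Fin d))) P) ∧
    ∀ i ω, x i ω = y i • μ + z i ω

/-- The signal-to-noise ratio `‖μ‖⁴ / (‖μ‖² + d / n)` (Euclidean norm). -/
def gmmSNR (n : ℕ) {d : ℕ} (μ : EuclideanSpace ℝ (Fin d)) : ℝ :=
  ‖μ‖ ^ 4 / (‖μ‖ ^ 2 + (d : ℝ) / (n : ℝ))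

/-- The hollowing operator: replace the diagonal of a square matrix by zero. -/
def hollow {n : ℕ} (A : Matrix (Fin n) (Fin n) ℝ) : Matrix (Fin n) (Fin n) ℝ :=
  Matrix.of fun i j => if i = j then 0 else A i j

/-- `u` is a unit eigenvector of `A` for the largest real eigenvalue of `A`. -/
def IsLeadingEigenvector {n : ℕ} (A : Matrix (Fin n) (Fin n) ℝ)
    (u : EuclideanSpace ℝ (Fin n)) : Prop :=
  ‖u‖ = 1 ∧ ∃ lam : ℝ, Module.End.HasEigenvector (Matrix.toEuclideanLin A) lam u ∧
    ∀ lam' : ℝ, Module.End.HasEigenvalue (Matrix.toEuclideanLin A) lam' → lam' ≤ lam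

/-- The entrywise sign `sgn(u)`, with `sgn(0) = 0`. -/
def signEstimator {n : ℕ} (u : EuclideanSpace ℝ (Fin n)) : Fin n → ℝ :=
  fun i => Real.sign (u i)

open Classical in
/-- The misclassification rate
`n⁻¹ min_{s = ±1} |{i : yhat i ≠ s * y i}|`. -/
def misclassRate {n : ℕ} (yhat y : Fin n → ℝ) : ℝ :=
  (min (Finset.univ.filter fun i => yhat i ≠ y i).card
    (Finset.univ.filter fun i => yhat i ≠ -y i).card : ℕ) / (n : ℝ)

end

/-! The expected hollowed Gram matrix is essentially `‖μ‖² y yᵀ`. Deleting the diagonal removes the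
common contribution `d` of the norms, so the remaining error has operator norm `O(√(nd) + n + n‖μ‖)
+ ‖μ‖²`. Relative to the signal size `n‖μ‖²` this is at most `perturbationLevel`, which tends to
zero when the SNR diverges. A net argument makes this hold outside an event of probability `6
exp(-2n)`, and Rayleigh quotients then align the leading eigenvector with `y`.

Alignment alone does not control individual signs. For that, replace `x i` by zero and let `q` be a
leading eigenvector of the resulting hollowed Gram matrix; then `q i = 0`, and `q` depends only on
the other samples. By `label_mul_inner_nonpos_of_leading`, the sign of `u i` can be wrong only if
that of `⟨x i, s⟩` is, where `s = ∑ j, q j • x j`. The comparison is exact, so no entrywise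
eigenvector perturbation bound is needed.

With the other samples frozen, `s` is fixed and `z i` is a fresh Gaussian, so an error has
probability at most `exp(-⟨μ, s⟩² / (2‖s‖²))`. Since `⟨μ, s⟩` is at least about `√n ‖μ‖²` and `‖s‖²`
is at most about `n‖μ‖² + d`, the exponent is at least `(1 - o(1)) SNR / 2`; this is
`gaussianSample_mislabelSet_le`. A union bound over the `n` labels gives exact recovery, and
averaging gives the rate, because for `SNR ≤ 2 log n` the term `6 exp(-2n)` is dominated by the
per-label bound. -/

/-! ### Gaussian moment generating functions and tails -/

lemma integral_exp_mul_sq_gaussianReal {s : ℝ} (hs : s < 1 / 2) :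
    ∫ x, Real.exp (s * x ^ 2) ∂(gaussianReal 0 1) = (√(1 - 2 * s))⁻¹ := by
  rw [integral_gaussianReal_eq_integral_smul one_ne_zero]
  have h : ∀ x : ℝ, gaussianPDFReal 0 1 x • Real.exp (s * x ^ 2) =
      (√(2 * Real.pi))⁻¹ * Real.exp (-(1 / 2 - s) * x ^ 2) := by
    intro x
    simp only [gaussianPDFReal, NNReal.coe_one, mul_one, sub_zero, smul_eq_mul]
    rw [mul_assoc, ← Real.exp_add]
    congr 2; ring
  simp_rw [h]
  rw [integral_const_mul, integral_gaussian, ← Real.sqrt_inv, ← Real.sqrt_mul (by positivity),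
    ← Real.sqrt_inv]
  congr 1
  have : 1 / 2 - s ≠ 0 := by linarith
  have : 1 - 2 * s ≠ 0 := by linarith
  have := Real.pi_ne_zero
  field_simp

lemma inv_sqrt_one_sub_le_exp {s : ℝ} (hs : |s| ≤ 1 / 4) :
    (√(1 - 2 * s))⁻¹ ≤ Real.exp (s + 4 * s ^ 2) := by
  obtain ⟨h1, h2⟩ := abs_le.1 hs
  have hp : 0 < 1 - 2 * s := by linarith
  have h : -(2 * (s + 4 * s ^ 2)) ≤ Real.log (1 - 2 * s) := by
    refine le_trans ?_ (Real.one_sub_inv_le_log_of_pos hp)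
    rw [← sub_nonneg]
    have : 1 - (1 - 2 * s)⁻¹ - -(2 * (s + 4 * s ^ 2)) = 4 * s ^ 2 * (1 - 4 * s) / (1 - 2 * s) := by
      field_simp; ring
    rw [this]
    have : 0 ≤ 1 - 4 * s := by linarith
    positivity
  rw [← Real.sqrt_inv]
  apply Real.sqrt_le_iff.2 ⟨(Real.exp_pos _).le, ?_⟩
  rw [← Real.exp_log (inv_pos.2 hp), Real.log_inv, ← Real.exp_nat_mul]
  apply Real.exp_le_exp.2
  push_cast
  linarith

lemma integral_exp_mul_norm_sq_stdGaussian (d : ℕ) {s : ℝ} (hs : s < 1 / 2) :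
    ∫ x, Real.exp (s * ‖x‖ ^ 2) ∂(stdGaussian (EuclideanSpace ℝ (Fin d))) =
      (√(1 - 2 * s))⁻¹ ^ d := by
  rw [← map_pi_eq_stdGaussian, integral_map (by fun_prop) (by fun_prop)]
  simp_rw [EuclideanSpace.real_norm_sq_eq, Finset.mul_sum, Real.exp_sum]
  rw [integral_fintype_prod_eq_prod (f := fun (_ : Fin d) x => Real.exp (s * x ^ 2))]
  simp [integral_exp_mul_sq_gaussianReal hs]

lemma integrable_exp_mul_norm_sq_stdGaussian (d : ℕ) {s : ℝ} (hs : s < 1 / 2) :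
    Integrable (fun x => Real.exp (s * ‖x‖ ^ 2)) (stdGaussian (EuclideanSpace ℝ (Fin d))) := by
  -- A non-integrable function has Bochner integral `0`, so the nonzero closed form already forces
  -- integrability.
  apply Integrable.of_integral_ne_zero
  rw [integral_exp_mul_norm_sq_stdGaussian d hs]
  have : 0 < √(1 - 2 * s) := Real.sqrt_pos.2 (by linarith)
  positivity

lemma stdGaussian_norm_sq_deviation (d : ℕ) {s τ : ℝ} (hs0 : 0 ≤ s) (hs : s ≤ 1 / 4) :
    (stdGaussian (EuclideanSpace ℝ (Fin d))).real {x | τ < |‖x‖ ^ 2 - d|} ≤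
      2 * Real.exp (4 * s ^ 2 * d - s * τ) := by
  set γ := stdGaussian (EuclideanSpace ℝ (Fin d))
  have hpow : ∀ r : ℝ, |r| ≤ 1 / 4 → mgf (fun x => ‖x‖ ^ 2) γ r ≤ Real.exp (d * (r + 4 * r ^ 2)) := by
    intro r hr
    have h2 : r < 1 / 2 := by linarith [(abs_le.1 hr).2]
    rw [mgf, integral_exp_mul_norm_sq_stdGaussian d h2, Real.exp_nat_mul]
    exact pow_le_pow_left₀ (by positivity) (inv_sqrt_one_sub_le_exp hr) d
  have h1 : γ.real {x | d + τ ≤ ‖x‖ ^ 2} ≤ Real.exp (4 * s ^ 2 * d - s * τ) := by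
    refine (measure_ge_le_exp_mul_mgf _ hs0
      (integrable_exp_mul_norm_sq_stdGaussian d (by linarith))).trans ?_
    refine (mul_le_mul_of_nonneg_left (hpow s (by rwa [abs_of_nonneg hs0]))
      (Real.exp_pos _).le).trans ?_
    rw [← Real.exp_add]
    exact Real.exp_le_exp.2 (by ring_nf; rfl)
  have h2 : γ.real {x | ‖x‖ ^ 2 ≤ d - τ} ≤ Real.exp (4 * s ^ 2 * d - s * τ) := by
    refine (measure_le_le_exp_mul_mgf (t := -s) _ (by linarith)
      (integrable_exp_mul_norm_sq_stdGaussian d (by linarith))).trans ?_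
    refine (mul_le_mul_of_nonneg_left (hpow (-s) (by rwa [abs_neg, abs_of_nonneg hs0]))
      (Real.exp_pos _).le).trans ?_
    rw [← Real.exp_add]
    exact Real.exp_le_exp.2 (by ring_nf; rfl)
  have hsub : {x : EuclideanSpace ℝ (Fin d) | τ < |‖x‖ ^ 2 - d|} ⊆
      {x | d + τ ≤ ‖x‖ ^ 2} ∪ {x | ‖x‖ ^ 2 ≤ d - τ} := by
    intro x hx
    rcases lt_abs.1 hx.out with h | h
    · left; simp only [Set.mem_ofPred_eq]; linarith
    · right; simp only [Set.mem_ofPred_eq]; linarith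
  calc _ ≤ _ := measureReal_mono hsub
    _ ≤ _ := measureReal_union_le _ _
    _ ≤ _ := by linarith

lemma stdGaussian_map_inner (d : ℕ) (w : EuclideanSpace ℝ (Fin d)) :
    (stdGaussian (EuclideanSpace ℝ (Fin d))).map (fun x => inner ℝ w x) =
      gaussianReal 0 (‖w‖ ^ 2).toNNReal := by
  have := IsGaussian.map_eq_gaussianReal (μ := stdGaussian (EuclideanSpace ℝ (Fin d)))
    (innerSL ℝ w)
  rw [integral_strongDual_stdGaussian, variance_dual_stdGaussian, innerSL_apply_norm] at this
  exact this

lemma stdGaussian_inner_tail (d : ℕ) {w : EuclideanSpace ℝ (Fin d)} (hw : w ≠ 0) {t : ℝ}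
    (ht : 0 ≤ t) :
    (stdGaussian (EuclideanSpace ℝ (Fin d))).real {x | t ≤ inner ℝ w x} ≤
      Real.exp (-t ^ 2 / (2 * ‖w‖ ^ 2)) := by
  set γ := stdGaussian (EuclideanSpace ℝ (Fin d))
  have hw' : 0 < ‖w‖ := norm_pos_iff.2 hw
  have hX : γ.map (fun x => inner ℝ w x) = gaussianReal 0 (‖w‖ ^ 2).toNNReal :=
    stdGaussian_map_inner d w
  have hint : Integrable (fun x => Real.exp (t / ‖w‖ ^ 2 * inner ℝ w x)) γ := by
    apply Integrable.of_integral_ne_zero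
    have := mgf_gaussianReal hX (t / ‖w‖ ^ 2)
    rw [mgf] at this
    rw [this]
    exact (Real.exp_pos _).ne'
  refine (measure_ge_le_exp_mul_mgf t (t := t / ‖w‖ ^ 2) (by positivity) hint).trans ?_
  rw [mgf_gaussianReal hX, ← Real.exp_add, Real.coe_toNNReal _ (by positivity)]
  apply Real.exp_le_exp.2
  apply le_of_eq
  field_simp
  ring

/-- Characteristic functions multiply, and `∑ j, a j ^ 2 = 1` collapses the product. Each net
direction thus reduces to a single standard Gaussian vector. -/
lemma map_pi_stdGaussian_sum_smul {n d : ℕ} (a : EuclideanSpace ℝ (Fin n)) (ha : ‖a‖ = 1) :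
    (Measure.pi fun _ : Fin n => stdGaussian (EuclideanSpace ℝ (Fin d))).map
      (fun z => ∑ j, a j • z j) = stdGaussian (EuclideanSpace ℝ (Fin d)) := by
  have hm : Measurable fun z : Fin n → EuclideanSpace ℝ (Fin d) => ∑ j, a j • z j := by fun_prop
  have := Measure.isProbabilityMeasure_map
    (μ := Measure.pi fun _ : Fin n => stdGaussian (EuclideanSpace ℝ (Fin d))) hm.aemeasurable
  apply Measure.ext_of_charFun
  ext t
  rw [charFun_apply, integral_map hm.aemeasurable (by fun_prop), charFun_stdGaussian]
  simp_rw [sum_inner, Complex.ofReal_sum, Finset.sum_mul, Complex.exp_sum]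
  rw [integral_fintype_prod_eq_prod (f := fun (j : Fin n) (x : EuclideanSpace ℝ (Fin d)) =>
    Complex.exp ((inner ℝ (a j • x) t : ℝ) * Complex.I))]
  have h : ∀ j, ∫ x : EuclideanSpace ℝ (Fin d),
      Complex.exp ((inner ℝ (a j • x) t : ℝ) * Complex.I) ∂(stdGaussian _) =
      Complex.exp (((-(a j) ^ 2 * ‖t‖ ^ 2 / 2 : ℝ)) : ℂ) := by
    intro j
    simp_rw [real_inner_smul_left, ← real_inner_smul_right]
    rw [← charFun_apply, charFun_stdGaussian, norm_smul]
    push_cast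
    rw [mul_pow, ← Complex.ofReal_pow ‖a j‖, Real.norm_eq_abs, sq_abs]
    push_cast
    congr 1; ring
  simp_rw [h]
  rw [← Complex.exp_sum, ← Complex.ofReal_sum, ← Finset.sum_div, ← Finset.sum_mul,
    Finset.sum_neg_distrib, ← EuclideanSpace.real_norm_sq_eq, ha]
  norm_num

/-! ### Nets on the sphere and quadratic forms -/

section Net
variable {E : Type*} [NormedAddCommGroup E] [InnerProductSpace ℝ E] [FiniteDimensional ℝ E]

/-- A maximal `1`-separated subset of the sphere of radius `2` is a `1`-net of it, and the
Besicovitch packing bound limits its size. Halving gives the net. -/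
lemma exists_half_net_sphere (E : Type*) [NormedAddCommGroup E] [InnerProductSpace ℝ E]
    [FiniteDimensional ℝ E] :
    ∃ N : Finset E, N.card ≤ 5 ^ Module.finrank ℝ E ∧ (∀ b ∈ N, ‖b‖ = 1) ∧
      ∀ a : E, ‖a‖ = 1 → ∃ b ∈ N, ‖a - b‖ ≤ 1 / 2 := by
  classical
  let p : Finset E → Prop := fun s => (∀ c ∈ s, ‖c‖ = 2) ∧ ∀ c ∈ s, ∀ d ∈ s, c ≠ d → 1 ≤ ‖c - d‖
  have hcard : ∀ s, p s → s.card ≤ 5 ^ Module.finrank ℝ E := fun s hs =>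
    Besicovitch.card_le_of_separated s (fun c hc => (hs.1 c hc).le) hs.2
  obtain ⟨s, hs, hmax⟩ : ∃ s, p s ∧ ∀ t, p t → t.card ≤ s.card := by
    have hne : (Finset.card '' {s | p s}).Nonempty := ⟨0, ∅, by simp [p], rfl⟩
    have hbdd : BddAbove (Finset.card '' {s | p s}) :=
      ⟨5 ^ Module.finrank ℝ E, by rintro _ ⟨s, hs, rfl⟩; exact hcard s hs⟩
    obtain ⟨s, hs, hs'⟩ := Nat.sSup_mem hne hbdd
    exact ⟨s, hs, fun t ht => hs' ▸ le_csSup hbdd ⟨t, ht, rfl⟩⟩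
  refine ⟨s.image fun c => (1 / 2 : ℝ) • c, Finset.card_image_le.trans (hcard s hs), ?_, ?_⟩
  · intro b hb
    obtain ⟨c, hc, rfl⟩ := Finset.mem_image.1 hb
    rw [norm_smul, hs.1 c hc]; norm_num
  · intro a ha
    suffices ∃ c ∈ s, ‖(2 : ℝ) • a - c‖ ≤ 1 by
      obtain ⟨c, hc, h⟩ := this
      refine ⟨_, Finset.mem_image_of_mem _ hc, ?_⟩
      have : a - (1 / 2 : ℝ) • c = (1 / 2 : ℝ) • ((2 : ℝ) • a - c) := by
        rw [smul_sub, smul_smul]; norm_num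
      rw [this, norm_smul]
      norm_num
      linarith
    by_contra! hcon
    have hnot : (2 : ℝ) • a ∉ s := fun h => by
      have := hcon _ h
      simp at this
      linarith
    have hp : p (insert ((2 : ℝ) • a) s) := by
      refine ⟨?_, ?_⟩
      · intro c hc
        rcases Finset.mem_insert.1 hc with rfl | hc
        · rw [norm_smul, ha]; norm_num
        · exact hs.1 c hc
      · intro c hc d hd hcd
        rcases Finset.mem_insert.1 hc with rfl | hc <;> rcases Finset.mem_insert.1 hd with rfl | hd
        · exact absurd rfl hcd
        · exact (hcon d hd).le
        · rw [norm_sub_rev]; exact (hcon c hc).le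
        · exact hs.2 c hc d hd hcd
    have := hmax _ hp
    rw [Finset.card_insert_of_notMem hnot] at this
    omega

/-- Let `a` maximize the form in absolute value over the unit sphere, with value `m`. Moving from
`a` to a net point changes the form by at most `31/32 * m`, so the net point still sees `m / 32`. -/
lemma abs_inner_self_le_of_half_net {T : E →ₗ[ℝ] E} (hT : T.IsSymmetric) {N : Finset E}
    (hN1 : ∀ b ∈ N, ‖b‖ = 1) (hN : ∀ a : E, ‖a‖ = 1 → ∃ b ∈ N, ‖a - b‖ ≤ 1 / 2) {M : ℝ}
    (hM : ∀ b ∈ N, |inner ℝ (T b) b| ≤ M) (v : E) : |inner ℝ (T v) v| ≤ 32 * M * ‖v‖ ^ 2 := by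
  rcases eq_or_ne v 0 with rfl | hv
  · simp
  have hcont : Continuous fun a : E => |inner ℝ (T a) a| :=
    ((LinearMap.continuous_of_finiteDimensional T).inner continuous_id).abs
  have hunit : ∀ w : E, w ≠ 0 → ‖‖w‖⁻¹ • w‖ = 1 := fun w hw => by
    rw [norm_smul, norm_inv, norm_norm, inv_mul_cancel₀ (norm_ne_zero_iff.2 hw)]
  obtain ⟨a, ha, hmax⟩ := (isCompact_sphere (0 : E) 1).exists_isMaxOn
    ⟨‖v‖⁻¹ • v, by simpa using hunit v hv⟩ hcont.continuousOn
  set m := |inner ℝ (T a) a| with hm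
  have hm0 : 0 ≤ m := abs_nonneg _
  have ha1 : ‖a‖ = 1 := by simpa using ha
  have hall : ∀ w : E, |inner ℝ (T w) w| ≤ m * ‖w‖ ^ 2 := by
    intro w
    rcases eq_or_ne w 0 with rfl | hw
    · simp
    have h := hmax (show ‖w‖⁻¹ • w ∈ Metric.sphere (0 : E) 1 by simpa using hunit w hw)
    simp only [Set.mem_ofPred_eq, map_smul, real_inner_smul_left, real_inner_smul_right,
      abs_mul, abs_inv, abs_norm] at h
    have hw' : 0 < ‖w‖ := norm_pos_iff.2 hw
    calc _ = ‖w‖ ^ 2 * (‖w‖⁻¹ * (‖w‖⁻¹ * |inner ℝ (T w) w|)) := by field_simp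
      _ ≤ ‖w‖ ^ 2 * m := by gcongr
      _ = _ := mul_comm _ _
  suffices m ≤ 32 * M from (hall v).trans (by gcongr)
  obtain ⟨b, hb, hab⟩ := hN a ha1
  have hb1 := hN1 b hb
  have hsym : inner ℝ (T a) b = inner ℝ (T b) a := by rw [hT a b, real_inner_comm]
  -- By symmetry the left side is `⟨T (a - b), a + b⟩`. Polarizing with weights `2` and `1/2`
  -- balances the short vector `a - b` against the long `a + b`; without weights the resulting
  -- factor would exceed `1`.
  have hdiff : inner ℝ (T a) a - inner ℝ (T b) b = (1 / 4) *
      (inner ℝ (T ((2 : ℝ) • (a - b) + (1 / 2 : ℝ) • (a + b)))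
        ((2 : ℝ) • (a - b) + (1 / 2 : ℝ) • (a + b)) -
      inner ℝ (T ((2 : ℝ) • (a - b) - (1 / 2 : ℝ) • (a + b)))
        ((2 : ℝ) • (a - b) - (1 / 2 : ℝ) • (a + b))) := by
    simp only [map_add, map_sub, map_smul, inner_add_left, inner_add_right, inner_sub_left,
      inner_sub_right, real_inner_smul_left, real_inner_smul_right, hsym]
    ring
  have hpar := parallelogram_law_with_norm ℝ ((2 : ℝ) • (a - b)) ((1 / 2 : ℝ) • (a + b))
  have hpar2 := parallelogram_law_with_norm ℝ a b
  have h1 := hall ((2 : ℝ) • (a - b) + (1 / 2 : ℝ) • (a + b))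
  have h2 := hall ((2 : ℝ) • (a - b) - (1 / 2 : ℝ) • (a + b))
  have h3 : |inner ℝ (T a) a - inner ℝ (T b) b| ≤ 31 / 32 * m := by
    rw [hdiff, abs_mul, abs_of_pos (by norm_num : (0 : ℝ) < 1 / 4)]
    have h4 := abs_sub (inner ℝ (T ((2 : ℝ) • (a - b) + (1 / 2 : ℝ) • (a + b)))
        ((2 : ℝ) • (a - b) + (1 / 2 : ℝ) • (a + b))) (inner ℝ (T ((2 : ℝ) • (a - b) - (1 / 2 : ℝ) • (a + b)))
        ((2 : ℝ) • (a - b) - (1 / 2 : ℝ) • (a + b)))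
    have h5 : m * (‖(2 : ℝ) • (a - b) + (1 / 2 : ℝ) • (a + b)‖ ^ 2 +
        ‖(2 : ℝ) • (a - b) - (1 / 2 : ℝ) • (a + b)‖ ^ 2) ≤ m * (31 / 8) := by
      apply mul_le_mul_of_nonneg_left _ hm0
      simp only [norm_smul, Real.norm_eq_abs, abs_of_pos (by norm_num : (0 : ℝ) < 2),
        abs_of_pos (by norm_num : (0 : ℝ) < 1 / 2)] at hpar
      rw [ha1, hb1] at hpar2
      have : ‖a - b‖ ^ 2 ≤ 1 / 4 := by nlinarith [norm_nonneg (a - b)]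
      nlinarith
    linarith
  have h4 := hM b hb
  have h5 : m - |inner ℝ (T b) b| ≤ |inner ℝ (T a) a - inner ℝ (T b) b| :=
    abs_sub_abs_le_abs_sub _ _
  linarith

end Net

/-! ### The hollowed Gram operator and its quadratic form -/

section Hollow
variable {n : ℕ} {F : Type*} [NormedAddCommGroup F] [InnerProductSpace ℝ F]

/-- The linear combination `∑ j, v j • x j`. -/
noncomputable def linComb (x : Fin n → F) (v : EuclideanSpace ℝ (Fin n)) : F := ∑ j, v j • x j

/-- The operator of the hollowed Gram matrix. -/
noncomputable def hollowGramOp (x : Fin n → F) :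
    EuclideanSpace ℝ (Fin n) →ₗ[ℝ] EuclideanSpace ℝ (Fin n) :=
  Matrix.toEuclideanLin (hollow (Matrix.gram ℝ x))

/-- The quadratic form of the hollowed Gram matrix. -/
noncomputable def hollowForm (x : Fin n → F) (v : EuclideanSpace ℝ (Fin n)) : ℝ :=
  ‖linComb x v‖ ^ 2 - ∑ j, v j ^ 2 * ‖x j‖ ^ 2

lemma inner_linComb_right (x : Fin n → F) (v : EuclideanSpace ℝ (Fin n)) (f : F) :
    inner ℝ f (linComb x v) = ∑ j, v j * inner ℝ f (x j) := by
  simp [linComb, inner_sum, real_inner_smul_right]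

lemma hollowGramOp_apply (x : Fin n → F) (v : EuclideanSpace ℝ (Fin n)) (i : Fin n) :
    hollowGramOp x v i = inner ℝ (x i) (linComb x v) - v i * ‖x i‖ ^ 2 := by
  rw [inner_linComb_right]
  have : hollowGramOp x v i = ∑ j, (if i = j then 0 else inner ℝ (x i) (x j)) * v j := by
    simp [hollowGramOp, Matrix.toLpLin_apply, Matrix.mulVec, dotProduct, hollow, Matrix.gram_apply]
  rw [this, eq_sub_iff_add_eq, ← Finset.add_sum_erase _ _ (Finset.mem_univ i),
    ← Finset.add_sum_erase (a := i) _ (fun j => v j * inner ℝ (x i) (x j)) (Finset.mem_univ i)]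
  rw [if_pos rfl, zero_mul, zero_add, real_inner_self_eq_norm_sq, add_comm]
  congr 1
  apply Finset.sum_congr rfl
  intro j hj
  rw [if_neg (Finset.ne_of_mem_erase hj).symm, mul_comm]

lemma inner_hollowGramOp (x : Fin n → F) (v w : EuclideanSpace ℝ (Fin n)) :
    inner ℝ (hollowGramOp x v) w =
      inner ℝ (linComb x v) (linComb x w) - ∑ j, v j * w j * ‖x j‖ ^ 2 := by
  rw [inner_linComb_right, PiLp.inner_apply, ← Finset.sum_sub_distrib]
  apply Finset.sum_congr rfl
  intro j _
  rw [hollowGramOp_apply, real_inner_comm]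
  simp
  rw [real_inner_comm]
  ring

lemma hollowGramOp_isSymmetric (x : Fin n → F) : (hollowGramOp x).IsSymmetric := by
  intro v w
  rw [real_inner_comm _ v, inner_hollowGramOp, inner_hollowGramOp, real_inner_comm]
  congr 1
  exact Finset.sum_congr rfl fun j _ => by ring

lemma inner_hollowGramOp_self (x : Fin n → F) (v : EuclideanSpace ℝ (Fin n)) :
    inner ℝ (hollowGramOp x v) v = hollowForm x v := by
  rw [inner_hollowGramOp, hollowForm, real_inner_self_eq_norm_sq]
  congr 1
  exact Finset.sum_congr rfl fun j _ => by ring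

lemma inner_self_le_of_eigenvalue_le {E : Type*} [NormedAddCommGroup E] [InnerProductSpace ℝ E]
    [FiniteDimensional ℝ E] {T : E →ₗ[ℝ] E} (hT : T.IsSymmetric) {lam : ℝ}
    (h : ∀ lam', Module.End.HasEigenvalue T lam' → lam' ≤ lam) (v : E) :
    inner ℝ (T v) v ≤ lam * ‖v‖ ^ 2 := by
  rw [real_inner_comm, ← hT.eigenvectorBasis rfl |>.sum_inner_mul_inner v (T v)]
  rw [← (hT.eigenvectorBasis rfl).sum_sq_inner_right, Finset.mul_sum]
  apply Finset.sum_le_sum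
  intro i _
  have : inner ℝ (hT.eigenvectorBasis rfl i) (T v) =
      hT.eigenvalues rfl i * inner ℝ (hT.eigenvectorBasis rfl i) v := by
    rw [← hT, hT.apply_eigenvectorBasis]
    simp [real_inner_smul_left]
  rw [this, real_inner_comm]
  have h1 := h _ (hT.hasEigenvalue_eigenvalues rfl i)
  have h2 := mul_le_mul_of_nonneg_right h1 (sq_nonneg (inner ℝ (hT.eigenvectorBasis rfl i) v))
  simp only [RCLike.ofReal_real_eq_id, id_eq] at h2
  linarith

lemma exists_leading_eigenvector {E : Type*} [NormedAddCommGroup E] [InnerProductSpace ℝ E]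
    [FiniteDimensional ℝ E] [Nontrivial E] {T : E →ₗ[ℝ] E} (hT : T.IsSymmetric) :
    ∃ (q : E) (r : ℝ), ‖q‖ = 1 ∧ T q = r • q ∧ ∀ v, inner ℝ (T v) v ≤ r * ‖v‖ ^ 2 := by
  have hpos : 0 < Module.finrank ℝ E := Module.finrank_pos
  obtain ⟨i, -, hi⟩ := Finset.exists_max_image Finset.univ (hT.eigenvalues rfl)
    ⟨⟨0, hpos⟩, Finset.mem_univ _⟩
  refine ⟨hT.eigenvectorBasis rfl i, hT.eigenvalues rfl i, by simp,
    by simp, inner_self_le_of_eigenvalue_le hT ?_⟩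
  intro lam' h
  obtain ⟨j, hj⟩ := hT.exists_eigenvalues_eq rfl h
  rw [← hj]
  exact hi j (Finset.mem_univ _)

end Hollow

/-! ### Deterministic closeness to the rank-one signal -/

section Deterministic
variable {n d : ℕ}

lemma linComb_single (z : Fin n → EuclideanSpace ℝ (Fin d)) (i : Fin n) :
    linComb z (EuclideanSpace.single i 1) = z i := by
  simp [linComb, PiLp.single_apply]

lemma norm_toLp_label_sq {y : Fin n → ℝ} (hy : ∀ i, y i = 1 ∨ y i = -1) :
    ‖WithLp.toLp 2 y‖ ^ 2 = n := by
  rw [EuclideanSpace.real_norm_sq_eq]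
  have : ∀ i, y i ^ 2 = 1 := fun i => by rcases hy i with h | h <;> rw [h] <;> norm_num
  simp [this]

/-- The linear combinations of `z` along the finite set `N` have squared norm within `τ` of `d`
and inner product with `μ` at most `ρ`. -/
def Concentrated (N : Finset (EuclideanSpace ℝ (Fin n))) (μ : EuclideanSpace ℝ (Fin d)) (τ ρ : ℝ)
    (z : Fin n → EuclideanSpace ℝ (Fin d)) : Prop :=
  ∀ a ∈ N, |‖linComb z a‖ ^ 2 - d| ≤ τ ∧ inner ℝ μ (linComb z a) ≤ ρ

/-- A half-net of the unit sphere containing the standard basis. -/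
structure IsBasicNet (N : Finset (EuclideanSpace ℝ (Fin n))) : Prop where
  norm_eq : ∀ b ∈ N, ‖b‖ = 1
  net : ∀ a : EuclideanSpace ℝ (Fin n), ‖a‖ = 1 → ∃ b ∈ N, ‖a - b‖ ≤ 1 / 2
  single_mem : ∀ i, EuclideanSpace.single i 1 ∈ N

lemma exists_isBasicNet (n : ℕ) :
    ∃ N : Finset (EuclideanSpace ℝ (Fin n)), IsBasicNet N ∧ N.card ≤ 5 ^ n + n := by
  classical
  obtain ⟨N, h1, h2, h3⟩ := exists_half_net_sphere (EuclideanSpace ℝ (Fin n))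
  rw [finrank_euclideanSpace_fin] at h1
  refine ⟨N ∪ Finset.univ.image fun i => EuclideanSpace.single i 1, ⟨?_, ?_, ?_⟩, ?_⟩
  · intro b hb
    rcases Finset.mem_union.1 hb with hb | hb
    · exact h2 b hb
    · obtain ⟨i, -, rfl⟩ := Finset.mem_image.1 hb
      simp
  · intro a ha
    obtain ⟨b, hb, h⟩ := h3 a ha
    exact ⟨b, Finset.mem_union_left _ hb, h⟩
  · intro i
    exact Finset.mem_union_right _ (Finset.mem_image_of_mem _ (Finset.mem_univ i))
  · refine (Finset.card_union_le _ _).trans (add_le_add h1 (Finset.card_image_le.trans ?_))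
    simp

variable {N : Finset (EuclideanSpace ℝ (Fin n))} {μ : EuclideanSpace ℝ (Fin d)} {τ ρ : ℝ}
  {z : Fin n → EuclideanSpace ℝ (Fin d)} {y : Fin n → ℝ}

lemma Concentrated.abs_norm_sq_sub_le (hN : IsBasicNet N) (h : Concentrated N μ τ ρ z)
    (i : Fin n) : |‖z i‖ ^ 2 - d| ≤ τ := by
  simpa [linComb_single] using (h _ (hN.single_mem i)).1

/-- On a unit vector the weights `b j ^ 2` sum to `1`, so `d` cancels between the full form and its
diagonal. What is left is two deviations of size `τ`, and the net lemma extends the bound to all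
vectors. -/
lemma Concentrated.abs_hollowForm_le (hN : IsBasicNet N) (h : Concentrated N μ τ ρ z)
    (v : EuclideanSpace ℝ (Fin n)) : |hollowForm z v| ≤ 64 * τ * ‖v‖ ^ 2 := by
  rw [← inner_hollowGramOp_self]
  refine (abs_inner_self_le_of_half_net (hollowGramOp_isSymmetric z) hN.norm_eq hN.net
    (M := 2 * τ) ?_ v).trans (le_of_eq (by ring))
  intro b hb
  rw [inner_hollowGramOp_self]
  have hb1 : ∑ j, b j ^ 2 = 1 := by
    rw [← EuclideanSpace.real_norm_sq_eq, hN.norm_eq b hb]; norm_num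
  have h1 : hollowForm z b = (‖linComb z b‖ ^ 2 - d) - ∑ j, b j ^ 2 * (‖z j‖ ^ 2 - d) := by
    simp only [hollowForm, mul_sub, Finset.sum_sub_distrib, ← Finset.sum_mul, hb1]
    ring
  have h2 : |∑ j, b j ^ 2 * (‖z j‖ ^ 2 - d)| ≤ τ := by
    calc _ ≤ ∑ j, |b j ^ 2 * (‖z j‖ ^ 2 - d)| := Finset.abs_sum_le_sum_abs _ _
      _ ≤ ∑ j, b j ^ 2 * τ := by
        apply Finset.sum_le_sum
        intro j _
        rw [abs_mul, abs_of_nonneg (sq_nonneg _)]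
        exact mul_le_mul_of_nonneg_left (h.abs_norm_sq_sub_le hN j) (sq_nonneg _)
      _ = τ := by rw [← Finset.sum_mul, hb1, one_mul]
  rw [h1]
  refine (abs_sub _ _).trans ?_
  linarith [(h b hb).1]

lemma Concentrated.abs_inner_linComb_le (hN : IsBasicNet N) (h : Concentrated N μ τ ρ z)
    (hρ : 0 ≤ ρ) (v : EuclideanSpace ℝ (Fin n)) : |inner ℝ μ (linComb z v)| ≤ 2 * ρ * ‖v‖ := by
  set w : EuclideanSpace ℝ (Fin n) := WithLp.toLp 2 fun j => inner ℝ μ (z j) with hw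
  have hin : ∀ v : EuclideanSpace ℝ (Fin n), inner ℝ μ (linComb z v) = inner ℝ w v := by
    intro v
    rw [inner_linComb_right, PiLp.inner_apply]
    simp [hw]
  have hwn : ‖w‖ ≤ 2 * ρ := by
    rcases eq_or_ne w 0 with h0 | h0
    · rw [h0, norm_zero]; positivity
    have hpos : 0 < ‖w‖ := norm_pos_iff.2 h0
    obtain ⟨b, hb, hab⟩ := hN.net (‖w‖⁻¹ • w) (by
      rw [norm_smul, norm_inv, norm_norm, inv_mul_cancel₀ hpos.ne'])
    have h1 := (h b hb).2
    rw [hin] at h1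
    have h2 : inner ℝ w (‖w‖⁻¹ • w) = ‖w‖ := by
      rw [real_inner_smul_right, real_inner_self_eq_norm_sq]; field_simp
    have h3 := real_inner_le_norm w (‖w‖⁻¹ • w - b)
    rw [inner_sub_right, h2] at h3
    nlinarith
  rw [hin]
  exact (abs_real_inner_le_norm _ _).trans (mul_le_mul_of_nonneg_right hwn (norm_nonneg _))

/-- The samples `x i = y i • μ + z i`. -/
def mixturePoint (μ : EuclideanSpace ℝ (Fin d)) (y : Fin n → ℝ)
    (z : Fin n → EuclideanSpace ℝ (Fin d)) : Fin n → EuclideanSpace ℝ (Fin d) :=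
  fun i => y i • μ + z i

lemma linComb_mixturePoint (v : EuclideanSpace ℝ (Fin n)) :
    linComb (mixturePoint μ y z) v = (inner ℝ (WithLp.toLp 2 y) v) • μ + linComb z v := by
  simp only [linComb, mixturePoint, smul_add, Finset.sum_add_distrib, smul_smul, PiLp.inner_apply]
  rw [← Finset.sum_smul]
  simp

lemma norm_mixturePoint_sq (hy : ∀ i, y i = 1 ∨ y i = -1) (i : Fin n) :
    ‖mixturePoint μ y z i‖ ^ 2 = ‖μ‖ ^ 2 + 2 * (y i * inner ℝ μ (z i)) + ‖z i‖ ^ 2 := by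
  rw [mixturePoint, norm_add_sq_real, real_inner_smul_left, norm_smul, mul_pow]
  rcases hy i with h | h <;> rw [h] <;> norm_num

lemma Concentrated.abs_label_mul_inner_le (hN : IsBasicNet N) (h : Concentrated N μ τ ρ z)
    (hρ : 0 ≤ ρ) (hy : ∀ i, y i = 1 ∨ y i = -1) (i : Fin n) :
    |y i * inner ℝ μ (z i)| ≤ 2 * ρ := by
  have h1 := h.abs_inner_linComb_le hN hρ (EuclideanSpace.single i 1)
  rw [linComb_single] at h1
  rw [abs_mul]
  rcases hy i with h | h <;> rw [h] <;> simpa using h1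

/-- The hollowed Gram matrix of `x` is `ε`-close to its rank-one signal `‖μ‖² y yᵀ`. -/
structure SignalDominates (ε : ℝ) (μ : EuclideanSpace ℝ (Fin d)) (y : Fin n → ℝ)
    (x : Fin n → EuclideanSpace ℝ (Fin d)) : Prop where
  form : ∀ v, |hollowForm x v - ‖μ‖ ^ 2 * inner ℝ (WithLp.toLp 2 y) v ^ 2| ≤
    ε * (n * ‖μ‖ ^ 2) * ‖v‖ ^ 2
  norm_sq : ∀ i, ‖x i‖ ^ 2 ≤ d + ε * (n * ‖μ‖ ^ 2)
  inner_mean : ∀ v, |inner ℝ μ (linComb x v) - ‖μ‖ ^ 2 * inner ℝ (WithLp.toLp 2 y) v| ≤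
    ε * (√n * ‖μ‖ ^ 2) * ‖v‖

lemma Concentrated.signalDominates (hN : IsBasicNet N) (h : Concentrated N μ τ ρ z)
    (hρ : 0 ≤ ρ) (hy : ∀ i, y i = 1 ∨ y i = -1) {ε : ℝ}
    (h1 : 4 * √n * ρ + 64 * τ + ‖μ‖ ^ 2 + 4 * ρ ≤ ε * (n * ‖μ‖ ^ 2))
    (h2 : 2 * ρ ≤ ε * (√n * ‖μ‖ ^ 2)) : SignalDominates ε μ y (mixturePoint μ y z) := by
  have hYn : ‖WithLp.toLp 2 y‖ = √n := by
    rw [← norm_toLp_label_sq hy, Real.sqrt_sq (norm_nonneg _)]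
  refine ⟨fun v => ?_, fun i => ?_, fun v => ?_⟩
  · refine le_trans ?_ (mul_le_mul_of_nonneg_right h1 (sq_nonneg _))
    -- Expanding leaves the cross term, the pure noise form, and the diagonal corrections due to
    -- `μ`.
    have e1 : hollowForm (mixturePoint μ y z) v - ‖μ‖ ^ 2 * inner ℝ (WithLp.toLp 2 y) v ^ 2 =
        2 * (inner ℝ (WithLp.toLp 2 y) v * inner ℝ μ (linComb z v)) + hollowForm z v
          - ‖μ‖ ^ 2 * ‖v‖ ^ 2 - 2 * ∑ j, v j ^ 2 * (y j * inner ℝ μ (z j)) := by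
      simp only [hollowForm, norm_mixturePoint_sq hy, linComb_mixturePoint, mul_add,
        Finset.sum_add_distrib, ← Finset.sum_mul]
      rw [norm_add_sq_real, real_inner_smul_left, norm_smul, mul_pow, Real.norm_eq_abs, sq_abs,
        EuclideanSpace.real_norm_sq_eq v, Finset.mul_sum _ (fun j => v j ^ 2 * (y j * inner ℝ μ (z j)))]
      have : ∑ j, v j ^ 2 * (2 * (y j * inner ℝ μ (z j))) =
          ∑ j, 2 * (v j ^ 2 * (y j * inner ℝ μ (z j))) :=
        Finset.sum_congr rfl fun j _ => by ring
      rw [this]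
      ring
    have b1 : |inner ℝ (WithLp.toLp 2 y) v * inner ℝ μ (linComb z v)| ≤
        (√n * ‖v‖) * (2 * ρ * ‖v‖) := by
      rw [abs_mul]
      apply mul_le_mul _ (h.abs_inner_linComb_le hN hρ v) (abs_nonneg _) (by positivity)
      rw [← hYn]
      exact abs_real_inner_le_norm _ _
    have b2 := h.abs_hollowForm_le hN v
    have b3 : |∑ j, v j ^ 2 * (y j * inner ℝ μ (z j))| ≤ 2 * ρ * ‖v‖ ^ 2 := by
      rw [EuclideanSpace.real_norm_sq_eq v, Finset.mul_sum]
      refine (Finset.abs_sum_le_sum_abs _ _).trans (Finset.sum_le_sum fun j _ => ?_)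
      rw [abs_mul, abs_of_nonneg (sq_nonneg _), mul_comm]
      exact mul_le_mul_of_nonneg_right (h.abs_label_mul_inner_le hN hρ hy j) (sq_nonneg _)
    have b4 : 0 ≤ ‖μ‖ ^ 2 * ‖v‖ ^ 2 := by positivity
    rw [e1, abs_le]
    rw [abs_le] at b1 b2 b3
    constructor <;> nlinarith
  · rw [norm_mixturePoint_sq hy]
    have b1 := abs_le.1 (h.abs_label_mul_inner_le hN hρ hy i)
    have b2 := abs_le.1 (h.abs_norm_sq_sub_le hN i)
    have b3 : 0 ≤ τ := (abs_nonneg _).trans (h.abs_norm_sq_sub_le hN i)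
    have b4 : 0 ≤ √n * ρ := by positivity
    linarith
  · rw [linComb_mixturePoint, inner_add_right, real_inner_smul_right, real_inner_self_eq_norm_sq,
      mul_comm, add_sub_cancel_left]
    exact (h.abs_inner_linComb_le hN hρ v).trans
      (mul_le_mul_of_nonneg_right h2 (norm_nonneg _))

end Deterministic

/-! ### Leave-one-out comparison of eigenvectors -/

section LeaveOneOut
variable {n d : ℕ} {ε : ℝ} {μ : EuclideanSpace ℝ (Fin d)} {y : Fin n → ℝ}
  {x : Fin n → EuclideanSpace ℝ (Fin d)}

lemma linComb_update_zero {F : Type*} [NormedAddCommGroup F] [InnerProductSpace ℝ F]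
    (x : Fin n → F) (i : Fin n) {v : EuclideanSpace ℝ (Fin n)}
    (hv : v i = 0) : linComb (Function.update x i 0) v = linComb x v := by
  apply Finset.sum_congr rfl
  intro j _
  rcases eq_or_ne j i with rfl | hj
  · simp [hv]
  · rw [Function.update_of_ne hj]

lemma hollowForm_update_zero {F : Type*} [NormedAddCommGroup F] [InnerProductSpace ℝ F]
    (x : Fin n → F) (i : Fin n) {v : EuclideanSpace ℝ (Fin n)}
    (hv : v i = 0) : hollowForm (Function.update x i 0) v = hollowForm x v := by
  rw [hollowForm, hollowForm, linComb_update_zero x i hv]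
  congr 1
  apply Finset.sum_congr rfl
  intro j _
  rcases eq_or_ne j i with rfl | hj
  · simp [hv]
  · rw [Function.update_of_ne hj]

/-- A unit eigenvector for the largest eigenvalue `r` of the hollowed Gram matrix. -/
structure IsLeadingPair {F : Type*} [NormedAddCommGroup F] [InnerProductSpace ℝ F]
    (x : Fin n → F) (q : EuclideanSpace ℝ (Fin n)) (r : ℝ) : Prop where
  norm_eq : ‖q‖ = 1
  eigen : hollowGramOp x q = r • q
  le : ∀ v, hollowForm x v ≤ r * ‖v‖ ^ 2

lemma IsLeadingPair.hollowForm_eq {F : Type*} [NormedAddCommGroup F] [InnerProductSpace ℝ F]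
    {x : Fin n → F} {q : EuclideanSpace ℝ (Fin n)} {r : ℝ} (h : IsLeadingPair x q r) :
    hollowForm x q = r := by
  rw [← inner_hollowGramOp_self, h.eigen, real_inner_smul_left, real_inner_self_eq_norm_sq,
    h.norm_eq]
  norm_num

lemma IsLeadingPair.neg {F : Type*} [NormedAddCommGroup F] [InnerProductSpace ℝ F]
    {x : Fin n → F} {q : EuclideanSpace ℝ (Fin n)} {r : ℝ} (h : IsLeadingPair x q r) :
    IsLeadingPair x (-q) r :=
  ⟨by rw [norm_neg, h.norm_eq], by rw [map_neg, h.eigen, smul_neg], h.le⟩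

lemma exists_isLeadingPair {F : Type*} [NormedAddCommGroup F] [InnerProductSpace ℝ F]
    (hn : 2 ≤ n) (x : Fin n → F) (w : EuclideanSpace ℝ (Fin n)) :
    ∃ q r, IsLeadingPair x q r ∧ 0 ≤ inner ℝ w q := by
  have : Nontrivial (EuclideanSpace ℝ (Fin n)) :=
    ⟨EuclideanSpace.single ⟨0, by omega⟩ 1, 0, by simp⟩
  obtain ⟨q, r, h1, h2, h3⟩ := exists_leading_eigenvector (hollowGramOp_isSymmetric x)
  have h : IsLeadingPair x q r := ⟨h1, h2, fun v => by rw [← inner_hollowGramOp_self]; exact h3 v⟩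
  rcases le_total 0 (inner ℝ w q) with h0 | h0
  · exact ⟨q, r, h, h0⟩
  · exact ⟨-q, r, h.neg, by rw [inner_neg_right]; linarith⟩

/-- Square roots are avoided through `(1 - 3ε)² ≤ 1 - 3ε`. -/
lemma label_inner_ge_of_sq_ge {a c : ℝ} (ha : 0 ≤ a) (hε0 : 0 ≤ ε)
    (hε : ε ≤ 1 / 20) (h : c ^ 2 * (1 - 3 * ε) ≤ a ^ 2) : c * (1 - 3 * ε) ≤ a := by
  apply le_of_sq_le_sq _ ha
  refine le_trans ?_ h
  rw [mul_pow]
  apply mul_le_mul_of_nonneg_left _ (sq_nonneg c)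
  nlinarith

/-- Testing the Rayleigh quotient at `y` bounds `lam` below by `(1 - ε) n ‖μ‖²`. Evaluating the form
at `u` bounds `lam` above through `⟨y, u⟩²`. -/
lemma SignalDominates.label_inner_leading_ge (h : SignalDominates ε μ y x) (hn : 2 ≤ n)
    (hy : ∀ i, y i = 1 ∨ y i = -1) (hμ : μ ≠ 0) (hεn : 1 / n ≤ ε) (hε : ε ≤ 1 / 20)
    {u : EuclideanSpace ℝ (Fin n)} {lam : ℝ} (hu : IsLeadingPair x u lam)
    (h0 : 0 ≤ inner ℝ (WithLp.toLp 2 y) u) :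
    0 < lam ∧ √n * (1 - 3 * ε) ≤ inner ℝ (WithLp.toLp 2 y) u := by
  have hn0 : (0 : ℝ) < n := by exact_mod_cast (by omega : 0 < n)
  have hε0 : 0 ≤ ε := le_trans (by positivity) hεn
  have hR : 0 < ‖μ‖ ^ 2 := by have := norm_pos_iff.2 hμ; positivity
  have h1 := abs_le.1 (h.form (WithLp.toLp 2 y))
  rw [real_inner_self_eq_norm_sq, norm_toLp_label_sq hy] at h1
  have h2 := hu.le (WithLp.toLp 2 y)
  rw [norm_toLp_label_sq hy] at h2
  have h3 := abs_le.1 (h.form u)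
  rw [hu.hollowForm_eq, hu.norm_eq] at h3
  have h4 : n * ‖μ‖ ^ 2 * (1 - ε) ≤ lam := by
    apply le_of_mul_le_mul_right _ hn0
    linarith [h1.1]
  refine ⟨lt_of_lt_of_le (mul_pos (by positivity) (by linarith)) h4, ?_⟩
  apply label_inner_ge_of_sq_ge h0 hε0 hε
  rw [Real.sq_sqrt hn0.le]
  apply le_of_mul_le_mul_left _ hR
  have : 0 ≤ ε * (n * ‖μ‖ ^ 2) := by positivity
  linarith [h3.2]

/-- The full and leave-one-out forms agree on vectors vanishing at `i`, so closeness for the full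
sample suffices. The test vector is `y` with its `i`-th entry erased. The bound on `‖linComb x q‖²`
adds back the diagonal, which contributes about `d`. -/
lemma SignalDominates.leaveOneOut (h : SignalDominates ε μ y x) (hn : 2 ≤ n)
    (hy : ∀ i, y i = 1 ∨ y i = -1) (hμ : μ ≠ 0) (hεn : 1 / n ≤ ε) (hε : ε ≤ 1 / 20) (i : Fin n)
    {q : EuclideanSpace ℝ (Fin n)} {r : ℝ} (hq : IsLeadingPair (Function.update x i 0) q r)
    (h0 : 0 ≤ inner ℝ (WithLp.toLp 2 y) q) :
    q i = 0 ∧ √n * (1 - 3 * ε) ≤ inner ℝ (WithLp.toLp 2 y) q ∧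
    √n * ‖μ‖ ^ 2 * (1 - 4 * ε) ≤ inner ℝ μ (linComb x q) ∧
    ‖linComb x q‖ ^ 2 ≤ (1 + 2 * ε) * (n * ‖μ‖ ^ 2 + d) := by
  have hn0 : (0 : ℝ) < n := by exact_mod_cast (by omega : 0 < n)
  have hε0 : 0 ≤ ε := le_trans (by positivity) hεn
  have hR : 0 < ‖μ‖ ^ 2 := by have := norm_pos_iff.2 hμ; positivity
  set Y : EuclideanSpace ℝ (Fin n) := WithLp.toLp 2 y with hY
  have hyi : y i * y i = 1 := by rcases hy i with h | h <;> rw [h] <;> norm_num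
  set v : EuclideanSpace ℝ (Fin n) := Y - y i • EuclideanSpace.single i 1 with hv
  have hYs : inner ℝ Y (EuclideanSpace.single i (1 : ℝ)) = y i := by
    rw [EuclideanSpace.inner_single_right]; simp [hY]
  have hvi : v i = 0 := by simp [hv, hY]
  have hYv : inner ℝ Y v = n - 1 := by
    rw [hv, inner_sub_right, real_inner_smul_right, hYs, real_inner_self_eq_norm_sq,
      norm_toLp_label_sq hy, hyi]
  have hvv : ‖v‖ ^ 2 = n - 1 := by
    rw [← real_inner_self_eq_norm_sq]
    nth_rw 1 [hv]
    rw [inner_sub_left, hYv, real_inner_smul_left, EuclideanSpace.inner_single_left, hvi]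
    simp
  have h1 := abs_le.1 (h.form v)
  have h2 := hq.le v
  rw [hollowForm_update_zero x i hvi, hvv] at h2
  rw [hYv, hvv] at h1
  have hn1 : (0 : ℝ) < n - 1 := by
    have : (2 : ℝ) ≤ n := by exact_mod_cast hn
    linarith
  have h3 : ‖μ‖ ^ 2 * (n - 1) - ε * (n * ‖μ‖ ^ 2) ≤ r := by
    apply le_of_mul_le_mul_right _ hn1
    linarith [h1.1]
  have h1n : 1 ≤ ε * n := by rwa [div_le_iff₀ hn0] at hεn
  have h4 : n * ‖μ‖ ^ 2 * (1 - 2 * ε) ≤ r := by nlinarith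
  have hr : 0 < r := lt_of_lt_of_le (mul_pos (by positivity) (by linarith)) h4
  -- Row `i` of the operator vanishes, whereas the eigenvalue `r` is positive.
  have hqi : q i = 0 := by
    have h5 : hollowGramOp (Function.update x i 0) q i = r * q i := by
      rw [hq.eigen]; simp
    rw [hollowGramOp_apply] at h5
    simp at h5
    exact h5.resolve_left hr.ne'
  have h6 := abs_le.1 (h.form q)
  have h7 := hq.hollowForm_eq
  rw [hollowForm_update_zero x i hqi] at h7
  rw [h7, hq.norm_eq] at h6
  have h8 : √n * (1 - 3 * ε) ≤ inner ℝ Y q := by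
    apply label_inner_ge_of_sq_ge h0 hε0 hε
    rw [Real.sq_sqrt hn0.le]
    apply le_of_mul_le_mul_left _ hR
    linarith [h6.2]
  refine ⟨hqi, h8, ?_, ?_⟩
  · have h9 := (abs_le.1 (h.inner_mean q)).1
    rw [hq.norm_eq] at h9
    have := mul_le_mul_of_nonneg_left h8 hR.le
    linarith
  · have h9 : inner ℝ Y q ^ 2 ≤ n := by
      have := abs_real_inner_le_norm Y q
      rw [hq.norm_eq, mul_one] at this
      rw [← norm_toLp_label_sq hy, ← sq_abs]
      exact pow_le_pow_left₀ (abs_nonneg _) this 2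
    have h10 : ∑ j, q j ^ 2 * ‖x j‖ ^ 2 ≤ d + ε * (n * ‖μ‖ ^ 2) := by
      calc _ ≤ ∑ j, q j ^ 2 * (d + ε * (n * ‖μ‖ ^ 2)) :=
            Finset.sum_le_sum fun j _ => mul_le_mul_of_nonneg_left (h.norm_sq j) (sq_nonneg _)
        _ = _ := by
          rw [← Finset.sum_mul, ← EuclideanSpace.real_norm_sq_eq, hq.norm_eq]; norm_num
    rw [hollowForm] at h7
    have h11 : ‖μ‖ ^ 2 * inner ℝ Y q ^ 2 ≤ ‖μ‖ ^ 2 * n := mul_le_mul_of_nonneg_left h9 hR.le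
    have h12 : (0 : ℝ) ≤ ε * d := by positivity
    linarith [h6.2]

/-- Both vectors have cosine at least `17/20 = 1 - 3/20` with `w`, so `‖q + u‖ ≥ 17/10 > √2`. -/
lemma inner_pos_of_inner_ge {E : Type*} [NormedAddCommGroup E] [InnerProductSpace ℝ E]
    {w q u : E} {c : ℝ} (hw : ‖w‖ = c) (hc : 0 < c) (hq : ‖q‖ = 1) (hu : ‖u‖ = 1)
    (h1 : c * (17 / 20) ≤ inner ℝ w q) (h2 : c * (17 / 20) ≤ inner ℝ w u) : 0 < inner ℝ q u := by
  have h3 := real_inner_le_norm w (q + u)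
  rw [inner_add_right, hw] at h3
  have h4 : 17 / 10 ≤ ‖q + u‖ := by
    apply le_of_mul_le_mul_left _ hc
    linarith
  have h5 := norm_add_sq_real q u
  rw [hq, hu] at h5
  nlinarith

/-- The sign of a coordinate of the leading eigenvector is that of a leave-one-out statistic. -/
lemma label_mul_inner_nonpos_of_leading {F : Type*} [NormedAddCommGroup F] [InnerProductSpace ℝ F]
    {x : Fin n → F} {i : Fin n} {q u : EuclideanSpace ℝ (Fin n)} {r lam c : ℝ}
    (hq : IsLeadingPair (Function.update x i 0) q r) (hqi : q i = 0) (hu : IsLeadingPair x u lam)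
    (hlam : 0 < lam) (hqu : 0 < inner ℝ q u) (hc : c * u i ≤ 0) :
    c * inner ℝ (x i) (linComb x q) ≤ 0 := by
  by_contra! hpos
  set α := inner ℝ (x i) (linComb x q) with hα
  have hα0 : α ≠ 0 := by rintro h; rw [h] at hpos; simp at hpos
  set e : EuclideanSpace ℝ (Fin n) := EuclideanSpace.single i 1
  have hAq : hollowGramOp x q = r • q + α • e := by
    ext j
    rcases eq_or_ne j i with rfl | hj
    · rw [hollowGramOp_apply, ← hα, hqi]
      simp [e, hqi]
    · have h1 : hollowGramOp (Function.update x i 0) q j = r * q j := by rw [hq.eigen]; simp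
      rw [hollowGramOp_apply, linComb_update_zero x i hqi, Function.update_of_ne hj] at h1
      rw [hollowGramOp_apply, h1]
      simp [e, hj]
  have heu : ∀ w : EuclideanSpace ℝ (Fin n), inner ℝ e w = w i := fun w => by
    rw [EuclideanSpace.inner_single_left]; simp
  -- Pairing with `u` yields `α * u i = (lam - r) * ⟨q, u⟩`. The right side is nonnegative, so a
  -- wrong sign forces both sides to vanish and `r = lam`.
  have hsym := hollowGramOp_isSymmetric x q u
  rw [hAq, hu.eigen, inner_add_left, real_inner_smul_left, real_inner_smul_left,
    real_inner_smul_right, heu] at hsym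
  have hrl : r ≤ lam := by
    have := hu.le q
    rw [← hollowForm_update_zero x i hqi, hq.hollowForm_eq, hq.norm_eq] at this
    linarith
  have hαu : α * u i ≤ 0 := by
    have : (c * u i) * (c * α) ≤ 0 := mul_nonpos_of_nonpos_of_nonneg hc hpos.le
    have hc2 : 0 < c ^ 2 := by
      have : c ≠ 0 := by rintro h; rw [h] at hpos; simp at hpos
      positivity
    nlinarith
  have heq : r = lam := by
    apply le_antisymm hrl
    nlinarith
  -- This excludes the tie: the form at the test vector is `lam + 2α²/lam`, while `lam` times its
  -- squared norm is only `lam + α²/lam`.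
  have hv := hu.le (q + (α / lam) • e)
  have hee : ‖e‖ = 1 := by simp [e]
  have hqe : inner ℝ q e = 0 := by rw [real_inner_comm, heu, hqi]
  have hAee : inner ℝ (hollowGramOp x e) e = 0 := by
    rw [real_inner_comm, heu, hollowGramOp_apply]
    have : linComb x e = x i := by simp [linComb, e, PiLp.single_apply]
    rw [this, real_inner_self_eq_norm_sq]
    simp [e]
  have hAeq : inner ℝ (hollowGramOp x e) q = α := by
    rw [hollowGramOp_isSymmetric x e q, hAq, heu]
    simp [hqi, e]
  rw [← inner_hollowGramOp_self, map_add, map_smul, norm_add_sq_real, norm_smul, hee,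
    inner_add_left, inner_add_right, inner_add_right, real_inner_smul_left, real_inner_smul_left,
    real_inner_smul_right, real_inner_smul_right, real_inner_smul_right, hAee, hAeq, hAq,
    inner_add_left, inner_add_left, real_inner_smul_left, real_inner_smul_left,
    real_inner_smul_left, real_inner_smul_left, hqe, heu, heu, hqi, real_inner_self_eq_norm_sq,
    hq.norm_eq, heq, Real.norm_eq_abs, mul_pow, sq_abs] at hv
  have he1 : e i = 1 := by simp [e]
  rw [he1] at hv
  have : 0 < α ^ 2 / lam := by positivity
  have h2 : lam * (α / lam) ^ 2 = α ^ 2 / lam := by field_simp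
  have h3 : α / lam * α = α ^ 2 / lam := by field_simp
  linarith

end LeaveOneOut

/-! ### Concentration and the per-label error probability -/

section Probability
variable {n d : ℕ}

/-- Fubini in coordinate `i`: this is how conditioning on the remaining samples enters. -/
lemma measure_pi_le_of_forall_update {ι : Type*} [Fintype ι] [DecidableEq ι] {X : ι → Type*}
    [∀ i, MeasurableSpace (X i)] (ν : ∀ i, Measure (X i)) [∀ i, IsProbabilityMeasure (ν i)]
    {T : Set (∀ i, X i)} (hT : MeasurableSet T) (i : ι) {c : ℝ≥0∞}
    (h : ∀ z, ν i {t | Function.update z i t ∈ T} ≤ c) : Measure.pi ν T ≤ c := by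
  have hm : Measurable (T.indicator (1 : (∀ i, X i) → ℝ≥0∞)) := measurable_one.indicator hT
  rcases isEmpty_or_nonempty (∀ i, X i) with hE | ⟨⟨z₀⟩⟩
  · rw [Set.eq_empty_of_isEmpty T, measure_empty]; exact zero_le
  rw [← lintegral_indicator_one hT, lintegral_eq_lmarginal_univ z₀,
    lmarginal_erase' _ hm (Finset.mem_univ i)]
  have hle : (fun x => ∫⁻ t, T.indicator (1 : (∀ i, X i) → ℝ≥0∞) (Function.update x i t) ∂ν i) ≤
      fun _ => c := by
    intro x
    have h1 : ∀ t, T.indicator (1 : (∀ i, X i) → ℝ≥0∞) (Function.update x i t) =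
        ((fun t => Function.update x i t) ⁻¹' T).indicator 1 t := fun t => rfl
    simp_rw [h1]
    rw [lintegral_indicator_one (measurable_update x hT)]
    exact h x
  refine (lmarginal_mono hle z₀).trans (le_of_eq ?_)
  simp [lmarginal]

/-- The law of `n` independent standard Gaussian vectors in `ℝ^d`. -/
noncomputable abbrev gaussianSample (n d : ℕ) : Measure (Fin n → EuclideanSpace ℝ (Fin d)) :=
  Measure.pi fun _ : Fin n => stdGaussian (EuclideanSpace ℝ (Fin d))

lemma gaussianSample_deviation {μ : EuclideanSpace ℝ (Fin d)} (hμ : μ ≠ 0) (hn : 1 ≤ n)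
    {a : EuclideanSpace ℝ (Fin n)} (ha : ‖a‖ = 1) :
    (gaussianSample n d).real {z | ¬ (|‖linComb z a‖ ^ 2 - d| ≤ 20 * (√(n * d) + n) ∧
      inner ℝ μ (linComb z a) ≤ 4 * √n * ‖μ‖)} ≤ 3 * Real.exp (-4 * n) := by
  have hn0 : (1 : ℝ) ≤ n := by exact_mod_cast hn
  have hsn : 0 < √(n : ℝ) := Real.sqrt_pos.2 (by linarith)
  have hm : Measurable fun z : Fin n → EuclideanSpace ℝ (Fin d) => ∑ j, a j • z j := by fun_prop
  set γ := stdGaussian (EuclideanSpace ℝ (Fin d)) with hγ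
  set S : Set (EuclideanSpace ℝ (Fin d)) := {x | ¬ (|‖x‖ ^ 2 - d| ≤ 20 * (√(n * d) + n) ∧
      inner ℝ μ x ≤ 4 * √n * ‖μ‖)} with hS
  have hSm : MeasurableSet S := by
    have h1 : IsClosed {x : EuclideanSpace ℝ (Fin d) | |‖x‖ ^ 2 - d| ≤ 20 * (√(n * d) + n)} :=
      isClosed_le (by fun_prop) (by fun_prop)
    have h2 : IsClosed {x : EuclideanSpace ℝ (Fin d) | inner ℝ μ x ≤ 4 * √n * ‖μ‖} :=
      isClosed_le (by fun_prop) (by fun_prop)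
    exact (h1.inter h2).measurableSet.compl
  have h1 : (gaussianSample n d).real {z | ¬ (|‖linComb z a‖ ^ 2 - d| ≤ 20 * (√(n * d) + n) ∧
      inner ℝ μ (linComb z a) ≤ 4 * √n * ‖μ‖)} = γ.real S := by
    rw [hγ, ← map_pi_stdGaussian_sum_smul a ha, map_measureReal_apply hm hSm]
    rfl
  have hsub : S ⊆ {x | 20 * (√(n * d) + n) < |‖x‖ ^ 2 - d|} ∪
      {x | 4 * √n * ‖μ‖ ≤ inner ℝ μ x} := by
    intro x hx
    rw [hS, Set.mem_ofPred_eq, not_and_or, not_le, not_le] at hx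
    exact hx.imp id le_of_lt
  -- Chernoff parameter: it stays below `1/4`, makes the linear term exactly `5n`, and keeps the
  -- quadratic term at most `n`, leaving exponent `-4n`.
  set s : ℝ := √n / (4 * (√n + √d)) with hs
  have hs1 : s ≤ 1 / 4 := by
    rw [hs, div_le_div_iff₀ (by positivity) (by norm_num)]
    linarith [Real.sqrt_nonneg (d : ℝ)]
  have e1 : s * (20 * (√(n * d) + n)) = 5 * n := by
    have h : √(n : ℝ) * √n = n := Real.mul_self_sqrt (by positivity)
    rw [hs, Real.sqrt_mul (by positivity)]
    calc _ = √n / (4 * (√n + √d)) * (20 * (√n * √d + √n * √n)) := by rw [h]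
      _ = 5 * (√n * √n) := by field_simp; ring
      _ = _ := by rw [h]
  have e2 : 4 * s ^ 2 * d ≤ n := by
    have h : s * √d ≤ √n / 4 := by
      rw [hs, div_mul_eq_mul_div, div_le_div_iff₀ (by positivity) (by norm_num)]
      nlinarith [Real.sqrt_nonneg (d : ℝ)]
    have h2 : (s * √d) ^ 2 ≤ (√n / 4) ^ 2 := pow_le_pow_left₀ (by positivity) h 2
    have h3 : (s * √d) ^ 2 = s ^ 2 * d := by rw [mul_pow, Real.sq_sqrt (by positivity)]
    have h4 : (√(n : ℝ) / 4) ^ 2 = n / 16 := by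
      rw [div_pow, Real.sq_sqrt (by positivity)]; norm_num
    linarith
  have hA := stdGaussian_norm_sq_deviation d (τ := 20 * (√(n * d) + n))
    (by positivity : 0 ≤ s) hs1
  have hB := stdGaussian_inner_tail d hμ (t := 4 * √n * ‖μ‖) (by positivity)
  have hA' : Real.exp (4 * s ^ 2 * d - s * (20 * (√(n * d) + n))) ≤ Real.exp (-4 * n) :=
    Real.exp_le_exp.2 (by rw [e1]; linarith)
  have hB' : Real.exp (-(4 * √n * ‖μ‖) ^ 2 / (2 * ‖μ‖ ^ 2)) ≤ Real.exp (-4 * n) := by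
    apply Real.exp_le_exp.2
    have : 0 < ‖μ‖ := norm_pos_iff.2 hμ
    rw [mul_pow, mul_pow, Real.sq_sqrt (by positivity)]
    field_simp
    norm_num
  rw [h1]
  calc _ ≤ _ := measureReal_mono hsub
    _ ≤ _ := measureReal_union_le _ _
    _ ≤ _ := by linarith

/-- The net has at most `2 exp(2n)` points, which the individual bounds `3 exp(-4n)` absorb. -/
lemma gaussianSample_not_concentrated {μ : EuclideanSpace ℝ (Fin d)} (hμ : μ ≠ 0) (hn : 1 ≤ n)
    {N : Finset (EuclideanSpace ℝ (Fin n))} (hN : ∀ a ∈ N, ‖a‖ = 1) (hc : N.card ≤ 5 ^ n + n) :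
    (gaussianSample n d).real {z | ¬ Concentrated N μ (20 * (√(n * d) + n)) (4 * √n * ‖μ‖) z} ≤
      6 * Real.exp (-2 * n) := by
  have hset : {z : Fin n → EuclideanSpace ℝ (Fin d) |
      ¬ Concentrated N μ (20 * (√(n * d) + n)) (4 * √n * ‖μ‖) z} =
      ⋃ a ∈ N, {z | ¬ (|‖linComb z a‖ ^ 2 - d| ≤ 20 * (√(n * d) + n) ∧
        inner ℝ μ (linComb z a) ≤ 4 * √n * ‖μ‖)} := by
    ext z
    simp only [Concentrated, Set.mem_ofPred_eq, Set.mem_iUnion, not_forall, exists_prop]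
  rw [hset]
  refine (measureReal_biUnion_finset_le _ _).trans
    ((Finset.sum_le_sum fun a ha => gaussianSample_deviation hμ hn (hN a ha)).trans ?_)
  rw [Finset.sum_const, nsmul_eq_mul]
  have h5 : (5 : ℝ) ^ n ≤ Real.exp (2 * n) := by
    rw [mul_comm, Real.exp_nat_mul]
    apply pow_le_pow_left₀ (by norm_num)
    have := Real.exp_one_gt_d9
    rw [show (2 : ℝ) = 1 + 1 by norm_num, Real.exp_add]
    nlinarith
  have hn5 : (n : ℝ) ≤ 5 ^ n := by exact_mod_cast (Nat.lt_pow_self (by norm_num)).le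
  have hc' : (N.card : ℝ) ≤ 5 ^ n + n := by exact_mod_cast hc
  calc _ ≤ (2 * Real.exp (2 * n)) * (3 * Real.exp (-4 * n)) := by gcongr; linarith
    _ = 6 * (Real.exp (2 * n) * Real.exp (-4 * n)) := by ring
    _ = _ := by rw [← Real.exp_add]; ring_nf

/-- The samples `z` that are concentrated and for which some suitably oriented leading
eigenvector of the hollowed Gram matrix mislabels the index `i`. -/
def mislabelSet (N : Finset (EuclideanSpace ℝ (Fin n))) (μ : EuclideanSpace ℝ (Fin d))
    (y : Fin n → ℝ) (τ ρ : ℝ) (i : Fin n) : Set (Fin n → EuclideanSpace ℝ (Fin d)) :=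
  {z | Concentrated N μ τ ρ z ∧ ∃ u lam, IsLeadingPair (mixturePoint μ y z) u lam ∧
    0 ≤ inner ℝ (WithLp.toLp 2 y) u ∧ y i * u i ≤ 0}

lemma isClosed_concentrated (N : Finset (EuclideanSpace ℝ (Fin n)))
    (μ : EuclideanSpace ℝ (Fin d)) (τ ρ : ℝ) :
    IsClosed {z : Fin n → EuclideanSpace ℝ (Fin d) | Concentrated N μ τ ρ z} := by
  have : {z : Fin n → EuclideanSpace ℝ (Fin d) | Concentrated N μ τ ρ z} =
      ⋂ a ∈ N, {z | |‖linComb z a‖ ^ 2 - d| ≤ τ} ∩ {z | inner ℝ μ (linComb z a) ≤ ρ} := by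
    ext z
    simp [Concentrated]
  rw [this]
  refine isClosed_biInter fun a _ => ?_
  unfold linComb
  exact (isClosed_le (by fun_prop) (by fun_prop)).inter (isClosed_le (by fun_prop) (by fun_prop))

/-- Eliminates the eigenvalue, leaving conditions that are jointly closed in the sample and the
vector. -/
lemma isLeadingPair_iff {x : Fin n → EuclideanSpace ℝ (Fin d)} {u : EuclideanSpace ℝ (Fin n)}
    {lam : ℝ} : IsLeadingPair x u lam ↔ ‖u‖ = 1 ∧ lam = hollowForm x u ∧
      (∀ v, inner ℝ (linComb x u) (linComb x v) - ∑ j, u j * v j * ‖x j‖ ^ 2 =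
        hollowForm x u * inner ℝ u v) ∧ ∀ v, hollowForm x v ≤ hollowForm x u * ‖v‖ ^ 2 := by
  constructor
  · intro h
    refine ⟨h.norm_eq, h.hollowForm_eq.symm, fun v => ?_, by rw [h.hollowForm_eq]; exact h.le⟩
    rw [← inner_hollowGramOp, h.eigen, real_inner_smul_left, h.hollowForm_eq]
  · rintro ⟨h1, rfl, h2, h3⟩
    refine ⟨h1, ext_inner_right ℝ fun v => ?_, h3⟩
    rw [inner_hollowGramOp, h2, real_inner_smul_left]

/-- Projection along the compact unit sphere is a closed map, so the existential over `u` costs no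
measurability. -/
lemma isClosed_mislabelSet (N : Finset (EuclideanSpace ℝ (Fin n)))
    (μ : EuclideanSpace ℝ (Fin d)) (y : Fin n → ℝ) (τ ρ : ℝ) (i : Fin n) :
    IsClosed (mislabelSet N μ y τ ρ i) := by
  let K := Metric.sphere (0 : EuclideanSpace ℝ (Fin n)) 1
  have : CompactSpace K := isCompact_iff_compactSpace.1 (isCompact_sphere _ _)
  let C : Set ((Fin n → EuclideanSpace ℝ (Fin d)) × K) :=
    ((⋂ v : EuclideanSpace ℝ (Fin n), {p | inner ℝ (linComb (mixturePoint μ y p.1) p.2.1)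
        (linComb (mixturePoint μ y p.1) v) - ∑ j, p.2.1 j * v j * ‖mixturePoint μ y p.1 j‖ ^ 2 =
        hollowForm (mixturePoint μ y p.1) p.2.1 * inner ℝ p.2.1 v}) ∩
      ⋂ v : EuclideanSpace ℝ (Fin n), {p | hollowForm (mixturePoint μ y p.1) v ≤
        hollowForm (mixturePoint μ y p.1) p.2.1 * ‖v‖ ^ 2}) ∩
      ({p | 0 ≤ inner ℝ (WithLp.toLp 2 y) p.2.1} ∩ {p | y i * p.2.1 i ≤ 0})
  have hC : IsClosed C := by
    refine ((isClosed_iInter fun v => ?_).inter (isClosed_iInter fun v => ?_)).inter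
      ((isClosed_le ?_ ?_).inter (isClosed_le ?_ ?_))
    · refine isClosed_eq ?_ ?_ <;> simp only [hollowForm, linComb, mixturePoint] <;> fun_prop
    · refine isClosed_le ?_ ?_ <;> simp only [hollowForm, linComb, mixturePoint] <;> fun_prop
    all_goals fun_prop
  have hset : mislabelSet N μ y τ ρ i = {z | Concentrated N μ τ ρ z} ∩ Prod.fst '' C := by
    ext z
    constructor
    · rintro ⟨hc, u, lam, hu, h0, hi⟩
      obtain ⟨h1, -, h2, h3⟩ := isLeadingPair_iff.1 hu
      exact ⟨hc, (z, ⟨u, by simpa [K] using h1⟩),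
        ⟨⟨Set.mem_iInter.2 h2, Set.mem_iInter.2 h3⟩, h0, hi⟩, rfl⟩
    · rintro ⟨hc, ⟨_, u, hu⟩, ⟨⟨h2, h3⟩, h0, hi⟩, rfl⟩
      exact ⟨hc, u, _, isLeadingPair_iff.2 ⟨by simpa [K] using hu, rfl, Set.mem_iInter.1 h2,
        Set.mem_iInter.1 h3⟩, h0, hi⟩
  rw [hset]
  exact (isClosed_concentrated N μ τ ρ).inter (isClosedMap_fst_of_compactSpace _ hC)

lemma gaussianSample_mislabelSet_le {N : Finset (EuclideanSpace ℝ (Fin n))} (hN : IsBasicNet N)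
    {μ : EuclideanSpace ℝ (Fin d)} (hμ : μ ≠ 0) {y : Fin n → ℝ} (hy : ∀ i, y i = 1 ∨ y i = -1)
    (hn : 2 ≤ n) {τ ρ ε : ℝ} (hρ : 0 ≤ ρ)
    (h1 : 4 * √n * ρ + 64 * τ + ‖μ‖ ^ 2 + 4 * ρ ≤ ε * (n * ‖μ‖ ^ 2))
    (h2 : 2 * ρ ≤ ε * (√n * ‖μ‖ ^ 2)) (hεn : 1 / n ≤ ε) (hε : ε ≤ 1 / 20) (i : Fin n) :
    (gaussianSample n d).real (mislabelSet N μ y τ ρ i) ≤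
      Real.exp (-(gmmSNR n μ * ((1 - 4 * ε) ^ 2 / (1 + 2 * ε)) / 2)) := by
  set c := Real.exp (-(gmmSNR n μ * ((1 - 4 * ε) ^ 2 / (1 + 2 * ε)) / 2)) with hc
  suffices gaussianSample n d (mislabelSet N μ y τ ρ i) ≤ ENNReal.ofReal c from
    ENNReal.toReal_le_of_le_ofReal (Real.exp_pos _).le this
  refine measure_pi_le_of_forall_update _ (isClosed_mislabelSet N μ y τ ρ i).measurableSet i
    fun z => ?_
  rcases Set.eq_empty_or_nonempty {t | Function.update z i t ∈ mislabelSet N μ y τ ρ i} with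
    h | ⟨t₀, ht₀⟩
  · rw [h, measure_empty]; exact zero_le
  have hn0 : (0 : ℝ) < n := by exact_mod_cast (by omega : 0 < n)
  have hε0 : 0 ≤ ε := le_trans (by positivity) hεn
  have hR : 0 < ‖μ‖ ^ 2 := by have := norm_pos_iff.2 hμ; positivity
  set x' := Function.update (mixturePoint μ y z) i 0 with hx'
  have hupd : ∀ t, Function.update (mixturePoint μ y (Function.update z i t)) i 0 = x' := by
    intro t
    ext1 j
    rcases eq_or_ne j i with rfl | hj
    · simp [hx']
    · simp [hx', hj, mixturePoint]
  obtain ⟨q, r, hq, hq0⟩ := exists_isLeadingPair hn x' (WithLp.toLp 2 y)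
  have hloo := fun t (ht : Function.update z i t ∈ mislabelSet N μ y τ ρ i) =>
    (ht.1.signalDominates hN hρ hy h1 h2).leaveOneOut hn hy hμ hεn hε i (q := q) (r := r)
      (by rw [hupd]; exact hq) hq0
  -- Neither `q` nor `s` depends on coordinate `i`, so estimates from one concentrated point of the
  -- section serve the whole section.
  obtain ⟨hqi, hYq, hm, hs⟩ := hloo t₀ ht₀
  set s := linComb x' q with hsdef
  have hsx : ∀ t, linComb (mixturePoint μ y (Function.update z i t)) q = s := fun t => by
    rw [← linComb_update_zero _ i hqi, hupd]
  rw [hsx] at hm hs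
  have hmpos : 0 < √n * ‖μ‖ ^ 2 * (1 - 4 * ε) := by
    have := Real.sqrt_pos.2 hn0
    have : 0 < 1 - 4 * ε := by linarith
    positivity
  have hs0 : s ≠ 0 := by
    rintro h
    rw [h, inner_zero_right] at hm
    linarith
  have hyy : y i * y i = 1 := by rcases hy i with h | h <;> rw [h] <;> norm_num
  have hys : ‖-(y i • s)‖ = ‖s‖ := by
    rw [norm_neg, norm_smul]
    rcases hy i with h | h <;> rw [h] <;> norm_num
  have hsub : {t | Function.update z i t ∈ mislabelSet N μ y τ ρ i} ⊆
      {t | inner ℝ μ s ≤ inner ℝ (-(y i • s)) t} := by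
    intro t ht
    have hYq' := (hloo t ht).2.1
    obtain ⟨hconc, u, lam, hu, hu0, hui⟩ := ht
    have hdom := hconc.signalDominates hN hρ hy h1 h2
    obtain ⟨hlam, hYu⟩ := hdom.label_inner_leading_ge hn hy hμ hεn hε hu hu0
    have hYn : ‖WithLp.toLp 2 y‖ = √n := by
      rw [← norm_toLp_label_sq hy, Real.sqrt_sq (norm_nonneg _)]
    have hb : √(n : ℝ) * (17 / 20) ≤ √n * (1 - 3 * ε) :=
      mul_le_mul_of_nonneg_left (by linarith) (Real.sqrt_nonneg _)
    have hqu := inner_pos_of_inner_ge hYn (Real.sqrt_pos.2 hn0) hq.norm_eq hu.norm_eq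
      (hb.trans hYq) (hb.trans hYu)
    have hkey := label_mul_inner_nonpos_of_leading (c := y i) (by rw [hupd]; exact hq) hqi hu hlam
      hqu hui
    rw [hsx, mixturePoint, Function.update_self, inner_add_left, real_inner_smul_left, mul_add,
      ← mul_assoc, hyy, one_mul] at hkey
    rw [Set.mem_ofPred_eq, inner_neg_left, real_inner_smul_left, real_inner_comm t s]
    linarith
  refine (measure_mono hsub).trans ?_
  rw [← ofReal_measureReal]
  apply ENNReal.ofReal_le_ofReal
  refine (stdGaussian_inner_tail d (w := -(y i • s)) ?_ (hmpos.le.trans hm)).trans ?_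
  · rw [← norm_ne_zero_iff, hys]; exact norm_ne_zero_iff.2 hs0
  rw [hys, hc]
  apply Real.exp_le_exp.2
  have hspos : 0 < ‖s‖ ^ 2 := by have := norm_pos_iff.2 hs0; positivity
  have hfin : gmmSNR n μ * ((1 - 4 * ε) ^ 2 / (1 + 2 * ε)) ≤ inner ℝ μ s ^ 2 / ‖s‖ ^ 2 := by
    have e : gmmSNR n μ * ((1 - 4 * ε) ^ 2 / (1 + 2 * ε)) =
        (√n * ‖μ‖ ^ 2 * (1 - 4 * ε)) ^ 2 / ((1 + 2 * ε) * (n * ‖μ‖ ^ 2 + d)) := by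
      rw [gmmSNR, mul_pow, mul_pow, Real.sq_sqrt hn0.le]
      have : ‖μ‖ ^ 2 + (d : ℝ) / n = (n * ‖μ‖ ^ 2 + d) / n := by field_simp
      rw [this]
      have : (n * ‖μ‖ ^ 2 + d : ℝ) ≠ 0 := by positivity
      have : 1 + 2 * ε ≠ 0 := by positivity
      field_simp
    rw [e]
    gcongr
  have e2 : -inner ℝ μ s ^ 2 / (2 * ‖s‖ ^ 2) = -(inner ℝ μ s ^ 2 / ‖s‖ ^ 2 / 2) := by
    field_simp
  rw [e2]
  linarith

/-- The relative perturbation level of the hollowed Gram matrix. -/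
noncomputable def perturbationLevel (n : ℕ) (μ : EuclideanSpace ℝ (Fin d)) : ℝ :=
  1 / n + 3000 / √(gmmSNR n μ)

/-- The `1 / n` part absorbs the lone `‖μ‖²`. Every other term is a multiple of `n * k` with `k =
‖μ‖² / √SNR`, and the constants sum to `2592 ≤ 3000`. -/
lemma perturbationLevel_bounds {μ : EuclideanSpace ℝ (Fin d)} (hn : 2 ≤ n) (hS : 1 ≤ gmmSNR n μ) :
    μ ≠ 0 ∧ 4 * √n * (4 * √n * ‖μ‖) + 64 * (20 * (√(n * d) + n)) + ‖μ‖ ^ 2 + 4 * (4 * √n * ‖μ‖) ≤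
      perturbationLevel n μ * (n * ‖μ‖ ^ 2) ∧
    2 * (4 * √n * ‖μ‖) ≤ perturbationLevel n μ * (√n * ‖μ‖ ^ 2) := by
  have hn1 : (1 : ℝ) ≤ n := by exact_mod_cast (by omega : 1 ≤ n)
  have hn0 : (0 : ℝ) < n := by linarith
  have hμ : μ ≠ 0 := by
    rintro rfl
    simp [gmmSNR] at hS
    linarith
  have hR : 0 < ‖μ‖ := norm_pos_iff.2 hμ
  have hden : 0 < ‖μ‖ ^ 2 + (d : ℝ) / n := by positivity
  set S := gmmSNR n μ with hSd
  have hmul : S * (‖μ‖ ^ 2 + (d : ℝ) / n) = ‖μ‖ ^ 4 := by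
    rw [hSd, gmmSNR]; field_simp
  have hd : S * ((d : ℝ) / n) ≤ ‖μ‖ ^ 4 := by
    have : 0 ≤ S * ‖μ‖ ^ 2 := by positivity
    linarith
  have hSR : S ≤ ‖μ‖ ^ 2 := by
    have h1 : 0 ≤ S * ((d : ℝ) / n) := by positivity
    have h2 : S * ‖μ‖ ^ 2 ≤ ‖μ‖ ^ 2 * ‖μ‖ ^ 2 := by linarith
    exact le_of_mul_le_mul_right h2 (by positivity)
  have hs1 : 1 ≤ √S := Real.one_le_sqrt.2 hS
  have hs0 : 0 < √S := by linarith
  have hsR : √S ≤ ‖μ‖ := by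
    rw [← Real.sqrt_sq hR.le]; exact Real.sqrt_le_sqrt hSR
  set k := ‖μ‖ ^ 2 / √S with hk
  have k1 : ‖μ‖ ≤ k := by rw [hk, le_div_iff₀ hs0]; nlinarith
  have k2 : 1 ≤ k := by linarith
  have k3 : √(n * d) ≤ n * k := by
    rw [hk, ← mul_div_assoc, le_div_iff₀ hs0, ← Real.sqrt_mul (by positivity)]
    apply Real.sqrt_le_iff.2 ⟨by positivity, ?_⟩
    have : (n : ℝ) ^ 2 * (S * ((d : ℝ) / n)) ≤ n ^ 2 * ‖μ‖ ^ 4 := by gcongr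
    calc (n : ℝ) * d * S = n ^ 2 * (S * ((d : ℝ) / n)) := by field_simp
      _ ≤ _ := this
      _ = _ := by ring
  have hsn : √(n : ℝ) * √n = n := Real.mul_self_sqrt hn0.le
  have hsn1 : 1 ≤ √(n : ℝ) := Real.one_le_sqrt.2 hn1
  have hsnn : √(n : ℝ) ≤ n := by nlinarith
  have e1 : perturbationLevel n μ * (n * ‖μ‖ ^ 2) = ‖μ‖ ^ 2 + 3000 * (n * k) := by
    rw [perturbationLevel, ← hSd, hk]; field_simp
  have e2 : perturbationLevel n μ * (√n * ‖μ‖ ^ 2) = √n * ‖μ‖ ^ 2 / n + 3000 * (√n * k) := by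
    rw [perturbationLevel, ← hSd, hk]; field_simp
  refine ⟨hμ, ?_, ?_⟩
  · rw [e1]
    have a1 : n * ‖μ‖ ≤ n * k := by gcongr
    have a2 : √n * ‖μ‖ ≤ n * k := by gcongr
    have a3 : (n : ℝ) * 1 ≤ n * k := by gcongr
    have a4 : √(n : ℝ) * (√n * ‖μ‖) = n * ‖μ‖ := by rw [← mul_assoc, hsn]
    have a5 : 4 * √n * (4 * √n * ‖μ‖) = 16 * (n * ‖μ‖) := by rw [← a4]; ring
    rw [a5]
    linarith
  · rw [e2]
    have a1 : √n * ‖μ‖ ≤ √n * k := by gcongr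
    have a2 : 0 ≤ √n * ‖μ‖ ^ 2 / n := by positivity
    have a3 : 0 ≤ √n * ‖μ‖ := by positivity
    linarith

end Probability

/-! ### The misclassification rate -/

section Misclassification
variable {n : ℕ}

lemma misclassRate_nonneg (yhat y : Fin n → ℝ) : 0 ≤ misclassRate yhat y := by
  unfold misclassRate; positivity

lemma misclassRate_le_one (yhat y : Fin n → ℝ) : misclassRate yhat y ≤ 1 := by
  classical
  unfold misclassRate
  apply div_le_one_of_le₀ _ (Nat.cast_nonneg n)
  exact_mod_cast (min_le_left _ _).trans ((Finset.card_filter_le _ _).trans (by simp))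

-- The alternatives are the two global signs. The non-strict inequality counts zero coordinates as
-- errors, as `Real.sign 0 = 0` requires.
open Classical in
lemma misclassRate_signEstimator_le {u : EuclideanSpace ℝ (Fin n)} {y : Fin n → ℝ}
    (hy : ∀ i, y i = 1 ∨ y i = -1) (M : Finset (Fin n))
    (h : (∀ i, y i * u i ≤ 0 → i ∈ M) ∨ ∀ i, y i * -u i ≤ 0 → i ∈ M) :
    misclassRate (signEstimator u) y ≤ M.card / n := by
  have hsign : ∀ i, ∀ t : ℝ, 0 < y i * t → Real.sign t = y i := by
    intro i t ht
    rcases hy i with h | h <;> rw [h] at ht ⊢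
    · exact Real.sign_of_pos (by linarith)
    · exact Real.sign_of_neg (by linarith)
  unfold misclassRate
  gcongr
  rcases h with h | h
  · refine (min_le_left _ _).trans (Finset.card_le_card fun i hi => h i ?_)
    by_contra! hpos
    exact (Finset.mem_filter.1 hi).2 (hsign i _ hpos)
  · refine (min_le_right _ _).trans (Finset.card_le_card fun i hi => h i ?_)
    by_contra! hpos
    refine (Finset.mem_filter.1 hi).2 ?_
    rw [signEstimator, ← hsign i _ hpos, Real.sign_neg, neg_neg]

end Misclassification

/-! ### Transfer to the probability space of the model -/

section Transfer
variable {n d : ℕ} {Ω : Type*} [MeasurableSpace Ω] {P : Measure Ω}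
  {μ : EuclideanSpace ℝ (Fin d)} {y : Fin n → ℝ} {x : Fin n → Ω → EuclideanSpace ℝ (Fin d)}
  {u : Ω → EuclideanSpace ℝ (Fin n)}

lemma IsLeadingEigenvector.exists_isLeadingPair {F : Type*} [NormedAddCommGroup F]
    [InnerProductSpace ℝ F] {x : Fin n → F} {u : EuclideanSpace ℝ (Fin n)}
    (h : IsLeadingEigenvector (hollow (Matrix.gram ℝ x)) u) : ∃ lam, IsLeadingPair x u lam := by
  obtain ⟨h1, lam, h2, h3⟩ := h
  refine ⟨lam, h1, h2.apply_eq_smul, fun v => ?_⟩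
  rw [← inner_hollowGramOp_self]
  exact inner_self_le_of_eigenvalue_le (hollowGramOp_isSymmetric x) h3 v

/-- The bound on the probability that a given label is estimated wrongly. -/
noncomputable def mislabelBound (n : ℕ) {d : ℕ} (μ : EuclideanSpace ℝ (Fin d)) : ℝ :=
  Real.exp (-(gmmSNR n μ *
    ((1 - 4 * perturbationLevel n μ) ^ 2 / (1 + 2 * perturbationLevel n μ)) / 2))

open Classical in
lemma IsGMM.exists_error_events (hx : IsGMM P μ y x)
    (hu : ∀ᵐ ω ∂P, IsLeadingEigenvector (hollow (Matrix.gram ℝ fun i => x i ω)) (u ω))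
    (hS : 1 ≤ gmmSNR n μ) (hε : perturbationLevel n μ ≤ 1 / 20) :
    ∃ (B : Set Ω) (A : Fin n → Set Ω), MeasurableSet B ∧ (∀ i, MeasurableSet (A i)) ∧
      P.real B ≤ 6 * Real.exp (-2 * n) ∧ (∀ i, P.real (A i) ≤ mislabelBound n μ) ∧
      ∀ᵐ ω ∂P, ω ∉ B → misclassRate (signEstimator (u ω)) y ≤
        (Finset.univ.filter fun i => ω ∈ A i).card / n := by
  obtain ⟨hn, -, hy, z, hind, hlaw, hxz⟩ := hx
  obtain ⟨hμ, h1, h2⟩ := perturbationLevel_bounds hn hS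
  obtain ⟨N, hN, hcard⟩ := exists_isBasicNet n
  have hεn : 1 / (n : ℝ) ≤ perturbationLevel n μ := by
    rw [perturbationLevel]
    have : 0 ≤ 3000 / √(gmmSNR n μ) := by positivity
    linarith
  set τ : ℝ := 20 * (√(n * d) + n)
  set ρ : ℝ := 4 * √n * ‖μ‖
  have hρ : 0 ≤ ρ := by positivity
  let Z : Ω → Fin n → EuclideanSpace ℝ (Fin d) := fun ω i => z i ω
  have hZm : AEMeasurable Z P := aemeasurable_pi_lambda _ fun i => (hlaw i).aemeasurable
  have hZ : P.map Z = gaussianSample n d := by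
    have := hind.map_fun_eq_pi_map fun i => (hlaw i).aemeasurable
    simp_rw [(hlaw _).map_eq] at this
    exact this
  have hreal : ∀ T : Set (Fin n → EuclideanSpace ℝ (Fin d)), MeasurableSet T →
      P.real (toMeasurable P (Z ⁻¹' T)) = (gaussianSample n d).real T := by
    intro T hT
    rw [measureReal_def, measure_toMeasurable, ← hZ, measureReal_def,
      Measure.map_apply_of_aemeasurable hZm hT]
  -- The sample map is only a.e. measurable, so preimages are replaced by measurable hulls of the
  -- same measure.
  refine ⟨toMeasurable P (Z ⁻¹' {z | Concentrated N μ τ ρ z}ᶜ),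
    fun i => toMeasurable P (Z ⁻¹' mislabelSet N μ y τ ρ i), measurableSet_toMeasurable _ _,
    fun i => measurableSet_toMeasurable _ _, ?_, fun i => ?_, ?_⟩
  · rw [hreal _ (isClosed_concentrated N μ τ ρ).measurableSet.compl]
    exact gaussianSample_not_concentrated hμ (by omega) hN.norm_eq hcard
  · rw [hreal _ (isClosed_mislabelSet N μ y τ ρ i).measurableSet]
    exact gaussianSample_mislabelSet_le hN hμ hy hn hρ h1 h2 hεn hε i
  · filter_upwards [hu] with ω hω hB
    have hconc : Concentrated N μ τ ρ (Z ω) := by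
      by_contra hcon
      exact hB (subset_toMeasurable P _ hcon)
    have hxm : (fun i => x i ω) = mixturePoint μ y (Z ω) := funext fun i => hxz i ω
    rw [hxm] at hω
    obtain ⟨lam, hlam⟩ := hω.exists_isLeadingPair
    apply misclassRate_signEstimator_le hy
    have hmem : ∀ i, Z ω ∈ mislabelSet N μ y τ ρ i →
        i ∈ Finset.univ.filter fun i => ω ∈ toMeasurable P (Z ⁻¹' mislabelSet N μ y τ ρ i) :=
      fun i hi => Finset.mem_filter.2 ⟨Finset.mem_univ i, subset_toMeasurable P _ hi⟩
    rcases le_total 0 (inner ℝ (WithLp.toLp 2 y) (u ω)) with h0 | h0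
    · exact Or.inl fun i hi => hmem i ⟨hconc, u ω, lam, hlam, h0, hi⟩
    · exact Or.inr fun i hi => hmem i ⟨hconc, -u ω, lam, hlam.neg,
        by rw [inner_neg_right]; linarith, hi⟩

lemma IsGMM.integral_misclassRate_le [IsProbabilityMeasure P] (hx : IsGMM P μ y x)
    (hu : ∀ᵐ ω ∂P, IsLeadingEigenvector (hollow (Matrix.gram ℝ fun i => x i ω)) (u ω))
    (hS : 1 ≤ gmmSNR n μ) (hε : perturbationLevel n μ ≤ 1 / 20) :
    ∫ ω, misclassRate (signEstimator (u ω)) y ∂P ≤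
      6 * Real.exp (-2 * n) + mislabelBound n μ := by
  classical
  obtain ⟨B, A, hBm, hAm, hB, hA, hrate⟩ := hx.exists_error_events hu hS hε
  have hn0 : (0 : ℝ) < n := by exact_mod_cast (by have := hx.two_le_n; omega : 0 < n)
  have hBi : Integrable (B.indicator (1 : Ω → ℝ)) P := (integrable_const 1).indicator hBm
  have hAi : ∀ i, Integrable ((A i).indicator (1 : Ω → ℝ)) P :=
    fun i => (integrable_const 1).indicator (hAm i)
  have hsum : Integrable (fun ω => ∑ i, (A i).indicator (1 : Ω → ℝ) ω) P :=
    integrable_finsetSum _ fun i _ => hAi i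
  calc ∫ ω, misclassRate (signEstimator (u ω)) y ∂P
      ≤ ∫ ω, B.indicator (1 : Ω → ℝ) ω + (∑ i, (A i).indicator (1 : Ω → ℝ) ω) / n ∂P := by
        -- Only the majorant has to be integrable here.
        refine integral_mono_of_nonneg (ae_of_all _ fun ω => misclassRate_nonneg _ _)
          (hBi.add (hsum.div_const _)) ?_
        filter_upwards [hrate] with ω hω
        have hcard : ((Finset.univ.filter fun i => ω ∈ A i).card : ℝ) =
            ∑ i, (A i).indicator (1 : Ω → ℝ) ω := by
          simp [Set.indicator_apply]
        have hpos : 0 ≤ (∑ i, (A i).indicator (1 : Ω → ℝ) ω) / n := by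
          rw [← hcard]; positivity
        by_cases hωB : ω ∈ B
        · rw [Set.indicator_of_mem hωB, Pi.one_apply]
          linarith [misclassRate_le_one (signEstimator (u ω)) y]
        · rw [Set.indicator_of_notMem hωB, zero_add, ← hcard]
          exact hω hωB
    _ = P.real B + (∑ i, P.real (A i)) / n := by
        rw [integral_add hBi (hsum.div_const _), integral_div, integral_finsetSum _ fun i _ => hAi i,
          integral_indicator_one hBm]
        simp_rw [fun i => integral_indicator_one (μ := P) (hAm i)]
    _ ≤ 6 * Real.exp (-2 * n) + mislabelBound n μ := by
        refine add_le_add hB ?_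
        rw [div_le_iff₀ hn0]
        refine (Finset.sum_le_sum fun i _ => hA i).trans (le_of_eq ?_)
        simp [mul_comm]

lemma IsGMM.measure_misclassRate_ne_zero_le [IsProbabilityMeasure P] (hx : IsGMM P μ y x)
    (hu : ∀ᵐ ω ∂P, IsLeadingEigenvector (hollow (Matrix.gram ℝ fun i => x i ω)) (u ω))
    (hS : 1 ≤ gmmSNR n μ) (hε : perturbationLevel n μ ≤ 1 / 20) :
    P {ω | misclassRate (signEstimator (u ω)) y = 0}ᶜ ≤
      ENNReal.ofReal (6 * Real.exp (-2 * n) + n * mislabelBound n μ) := by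
  classical
  obtain ⟨B, A, hBm, hAm, hB, hA, hrate⟩ := hx.exists_error_events hu hS hε
  have hle : P {ω | misclassRate (signEstimator (u ω)) y = 0}ᶜ ≤ P (B ∪ ⋃ i ∈ Finset.univ, A i) := by
    apply measure_mono_ae
    filter_upwards [hrate] with ω hω hne
    change ω ∈ B ∪ ⋃ i ∈ Finset.univ, A i
    by_contra hcon
    rw [Set.mem_union, not_or] at hcon
    refine hne (le_antisymm ((hω hcon.1).trans (le_of_eq ?_)) (misclassRate_nonneg _ _))
    rw [Finset.filter_eq_empty_iff.2]
    · simp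
    · exact fun i hi hiA => hcon.2 (Set.mem_biUnion hi hiA)
  refine hle.trans ?_
  rw [← ofReal_measureReal]
  apply ENNReal.ofReal_le_ofReal
  refine (measureReal_union_le _ _).trans (add_le_add hB ?_)
  refine (measureReal_biUnion_finset_le _ _).trans
    ((Finset.sum_le_sum fun i _ => hA i).trans (le_of_eq ?_))
  simp

end Transfer

/-! ### Asymptotics of the bounds -/

section Asymptotics
variable {d : ℕ → ℕ} {μ : ∀ n, EuclideanSpace ℝ (Fin (d n))}

lemma tendsto_perturbationLevel (hS : Tendsto (fun n => gmmSNR n (μ n)) atTop atTop) :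
    Tendsto (fun n => perturbationLevel n (μ n)) atTop (𝓝 0) := by
  unfold perturbationLevel
  have h1 : Tendsto (fun n : ℕ => 1 / (n : ℝ)) atTop (𝓝 0) := tendsto_one_div_atTop_nhds_zero_nat
  have h2 : Tendsto (fun n => 3000 / √(gmmSNR n (μ n))) atTop (𝓝 0) :=
    tendsto_const_nhds.div_atTop (Real.tendsto_sqrt_atTop.comp hS)
  simpa using h1.add h2

lemma tendsto_exponent_ratio (hS : Tendsto (fun n => gmmSNR n (μ n)) atTop atTop) :
    Tendsto (fun n => (1 - 4 * perturbationLevel n (μ n)) ^ 2 /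
      (1 + 2 * perturbationLevel n (μ n))) atTop (𝓝 1) := by
  have h := tendsto_perturbationLevel hS
  have h1 : Tendsto (fun n => (1 - 4 * perturbationLevel n (μ n)) ^ 2) atTop (𝓝 ((1 - 4 * 0) ^ 2)) :=
    (tendsto_const_nhds.sub (h.const_mul 4)).pow 2
  have h2 : Tendsto (fun n => 1 + 2 * perturbationLevel n (μ n)) atTop (𝓝 (1 + 2 * 0)) :=
    tendsto_const_nhds.add (h.const_mul 2)
  have h3 := h1.div h2 (by norm_num)
  norm_num at h3
  exact h3

lemma tendsto_log_natCast_atTop : Tendsto (fun n : ℕ => Real.log n) atTop atTop :=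
  Real.tendsto_log_atTop.comp tendsto_natCast_atTop_atTop

lemma tendsto_exp_neg_two_mul_nat : Tendsto (fun n : ℕ => 6 * Real.exp (-2 * n)) atTop (𝓝 0) := by
  have h : Tendsto (fun n : ℕ => (-2 : ℝ) * n) atTop atBot :=
    tendsto_natCast_atTop_atTop.const_mul_atTop_of_neg (by norm_num)
  simpa using (Real.tendsto_exp_atBot.comp h).const_mul 6

lemma tendsto_natCast_mul_mislabelBound {ε : ℝ} (hε : 0 < ε)
    (hS : Tendsto (fun n => gmmSNR n (μ n)) atTop atTop)
    (h : ∀ᶠ n : ℕ in atTop, (2 + ε) * Real.log n < gmmSNR n (μ n)) :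
    Tendsto (fun n : ℕ => n * mislabelBound n (μ n)) atTop (𝓝 0) := by
  have hlim : Tendsto (fun n : ℕ => Real.exp (-(ε / 4) * Real.log n)) atTop (𝓝 0) :=
    Real.tendsto_exp_atBot.comp
      (tendsto_log_natCast_atTop.const_mul_atTop_of_neg (by linarith))
  -- With this ratio the per-label exponent is at least `(1 + ε/4) log n`, so the union bound is at
  -- most `n ^ (-ε/4)`.
  have hratio : (2 + ε / 2) / (2 + ε) < 1 := by rw [div_lt_one (by linarith)]; linarith
  refine squeeze_zero' (Eventually.of_forall fun n => by unfold mislabelBound; positivity) ?_ hlim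
  filter_upwards [h, (tendsto_exponent_ratio hS).eventually (lt_mem_nhds hratio),
    eventually_ge_atTop 2] with n h1 h2 hn
  have hn1 : (1 : ℝ) ≤ n := by exact_mod_cast (by omega : 1 ≤ n)
  have hlog : 0 ≤ Real.log n := Real.log_nonneg hn1
  have hn0 : (0 : ℝ) < n := by linarith
  unfold mislabelBound
  nth_rw 1 [← Real.exp_log hn0]
  rw [← Real.exp_add]
  apply Real.exp_le_exp.2
  have h3 : ((2 + ε) * Real.log n) * ((2 + ε / 2) / (2 + ε)) ≤ gmmSNR n (μ n) *
      ((1 - 4 * perturbationLevel n (μ n)) ^ 2 / (1 + 2 * perturbationLevel n (μ n))) :=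
    mul_le_mul h1.le h2.le (by positivity) (le_trans (by positivity) h1.le)
  have h4 : ((2 + ε) * Real.log n) * ((2 + ε / 2) / (2 + ε)) = (2 + ε / 2) * Real.log n := by
    field_simp
  rw [h4] at h3
  linarith

/-- The exponent ratio is at most `1`, so `SNR ≤ 2 log n` keeps the per-label bound above `1 / n`,
far larger than the concentration failure. -/
lemma exp_neg_two_mul_le_mislabelBound {n d : ℕ} {μ : EuclideanSpace ℝ (Fin d)} (hn : 2 ≤ n)
    (hS0 : 0 ≤ gmmSNR n μ) (hε : perturbationLevel n μ ≤ 1 / 20)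
    (hS : gmmSNR n μ ≤ 2 * Real.log n) :
    6 * Real.exp (-2 * n) ≤ mislabelBound n μ := by
  have hn2 : (2 : ℝ) ≤ n := by exact_mod_cast hn
  have hn0 : (0 : ℝ) < n := by linarith
  have hε0 : 0 ≤ perturbationLevel n μ := by unfold perturbationLevel; positivity
  have hratio : (1 - 4 * perturbationLevel n μ) ^ 2 / (1 + 2 * perturbationLevel n μ) ≤ 1 := by
    rw [div_le_one (by linarith)]
    nlinarith
  have h1 : (n : ℝ)⁻¹ ≤ mislabelBound n μ := by
    rw [← Real.exp_log hn0, ← Real.exp_neg, mislabelBound]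
    apply Real.exp_le_exp.2
    have := mul_le_mul_of_nonneg_left hratio hS0
    linarith
  refine le_trans ?_ h1
  have h2 : (n : ℝ) ≤ Real.exp n / 2 := by
    have : (2 : ℝ) ≤ Real.exp 1 := by linarith [Real.add_one_le_exp (1 : ℝ)]
    have h3 := Real.add_one_le_exp ((n : ℝ) - 1)
    have h4 : Real.exp n = Real.exp (n - 1) * Real.exp 1 := by rw [← Real.exp_add]; ring_nf
    rw [h4]
    nlinarith
  have h3 : (3 : ℝ) ≤ Real.exp n := by linarith [Real.add_one_le_exp (n : ℝ)]
  rw [show -2 * (n : ℝ) = -(n + n) by ring, Real.exp_neg, Real.exp_add, ← div_eq_mul_inv,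
    inv_eq_one_div, div_le_div_iff₀ (by positivity) hn0]
  nlinarith

end Asymptotics

/-! ### Exact recovery and the error exponent -/

theorem mainTheorem2
    {Ω : ℕ → Type*} [∀ n, MeasurableSpace (Ω n)]
    (P : ∀ n, Measure (Ω n)) [∀ n, IsProbabilityMeasure (P n)]
    (d : ℕ → ℕ)
    (μ : ∀ n, EuclideanSpace ℝ (Fin (d n)))
    (y : ∀ n, Fin n → ℝ)
    (x : ∀ n, Fin n → Ω n → EuclideanSpace ℝ (Fin (d n)))
    (hx : ∀ n, 2 ≤ n → IsGMM (P n) (μ n) (y n) (x n))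
    (u : ∀ n, Ω n → EuclideanSpace ℝ (Fin n))
    (hu_meas : ∀ n, 2 ≤ n → AEMeasurable (u n) (P n))
    (hu : ∀ n, 2 ≤ n → ∀ᵐ ω ∂(P n),
      IsLeadingEigenvector (hollow (Matrix.gram ℝ fun i => x n i ω)) (u n ω)) :
    (∀ ε : ℝ, 0 < ε →
      (∀ᶠ n : ℕ in atTop, (2 + ε) * Real.log n < gmmSNR n (μ n)) →
      Tendsto (fun n => P n {ω | misclassRate (signEstimator (u n ω)) (y n) = 0})
        atTop (𝓝 1)) ∧
    (Tendsto (fun n => gmmSNR n (μ n)) atTop atTop →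
      (∀ᶠ n : ℕ in atTop, gmmSNR n (μ n) ≤ 2 * Real.log n) →
      limsup (fun n => (((gmmSNR n (μ n))⁻¹ : ℝ) : EReal) *
          ENNReal.log (ENNReal.ofReal
            (∫ ω, misclassRate (signEstimator (u n ω)) (y n) ∂(P n)))) atTop
        ≤ ((-1 / 2 : ℝ) : EReal)) := by
  refine ⟨fun ε hε hlog => ?_, fun hS hlog => ?_⟩
  · have hS : Tendsto (fun n => gmmSNR n (μ n)) atTop atTop :=
      tendsto_atTop_mono' atTop (hlog.mono fun n h => h.le)
        (tendsto_log_natCast_atTop.const_mul_atTop (by linarith))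
    have hbad : Tendsto (fun n : ℕ => 1 - ENNReal.ofReal
        (6 * Real.exp (-2 * n) + n * mislabelBound n (μ n))) atTop (𝓝 1) := by
      have h := ENNReal.tendsto_ofReal
        (tendsto_exp_neg_two_mul_nat.add (tendsto_natCast_mul_mislabelBound hε hS hlog))
      simpa using ENNReal.Tendsto.sub tendsto_const_nhds h (Or.inl ENNReal.one_ne_top)
    refine tendsto_of_tendsto_of_tendsto_of_le_of_le' hbad tendsto_const_nhds ?_
      (Eventually.of_forall fun n => prob_le_one)
    filter_upwards [hS.eventually_ge_atTop 1, eventually_ge_atTop 2,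
      (tendsto_perturbationLevel hS).eventually (gt_mem_nhds (by norm_num : (0 : ℝ) < 1 / 20))]
      with n h1 hn h2
    have h3 := (hx n hn).measure_misclassRate_ne_zero_le (hu n hn) h1 h2.le
    rw [tsub_le_iff_right]
    calc (1 : ℝ≥0∞) = P n Set.univ := measure_univ.symm
      _ ≤ _ := measure_univ_le_add_compl _
      _ ≤ _ := add_le_add le_rfl h3
  -- The expected rate is at most twice the per-label bound; the factor `2` costs `log 2 / SNR`,
  -- which vanishes.
  · have hlim : Tendsto (fun n => (((gmmSNR n (μ n))⁻¹ * Real.log 2 -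
        (1 - 4 * perturbationLevel n (μ n)) ^ 2 / (1 + 2 * perturbationLevel n (μ n)) / 2 : ℝ) :
        EReal)) atTop (𝓝 ((-1 / 2 : ℝ) : EReal)) := by
      refine (continuous_coe_real_ereal.tendsto _).comp ?_
      have h := ((tendsto_inv_atTop_zero.comp hS).mul_const (Real.log 2)).sub
        ((tendsto_exponent_ratio hS).div_const 2)
      rw [zero_mul, zero_sub, ← neg_div] at h
      exact h
    rw [← hlim.limsup_eq]
    refine limsup_le_limsup ?_
    filter_upwards [hS.eventually_ge_atTop 1, eventually_ge_atTop 2, hlog,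
      (tendsto_perturbationLevel hS).eventually (gt_mem_nhds (by norm_num : (0 : ℝ) < 1 / 20))]
      with n h1 hn hl h2
    have h3 := (hx n hn).integral_misclassRate_le (hu n hn) h1 h2.le
    have h4 := exp_neg_two_mul_le_mislabelBound hn (by linarith) h2.le hl
    have hpos : 0 < mislabelBound n (μ n) := Real.exp_pos _
    have h5 : ENNReal.log (ENNReal.ofReal
        (∫ ω, misclassRate (signEstimator (u n ω)) (y n) ∂(P n))) ≤
        (Real.log (2 * mislabelBound n (μ n)) : EReal) := by
      rw [← ENNReal.log_ofReal_of_pos (by positivity)]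
      exact ENNReal.log_monotone (ENNReal.ofReal_le_ofReal (by linarith))
    refine (mul_le_mul_of_nonneg_left h5 (by exact_mod_cast (by positivity))).trans ?_
    rw [← EReal.coe_mul]
    apply EReal.coe_le_coe
    apply le_of_eq
    rw [Real.log_mul (by norm_num) hpos.ne', mislabelBound, Real.log_exp]
    have : gmmSNR n (μ n) ≠ 0 := by linarith
    rw [mul_add, mul_neg, mul_div_assoc, ← mul_assoc _ (gmmSNR n (μ n)), inv_mul_cancel₀ this,
      one_mul, ← sub_eq_add_neg]
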